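/- Let $d\ge 1$, $p,q\in(0,\infty]$, $k\in\mathbb N_0$, and let $\emptyset\neq\mathcal O\subset\mathbb R^d$ be open. Let $\mathcal Q=(Q_i)_{i\in I}=(T_iQ_i'+b_i)_{i\in I}$, with $T_i\in GL(\mathbb R^d)$, $b_i\in\mathbb R^d$, $Q_i'\subset\mathbb R^d$, be a tight semi-structured covering of $\mathcal O$. This means: $\bigcup_{i\in I}Q_i=\mathcal O$; all $Q_i$ are nonempty; with $i^*:=\{j\in I: Q_i\cap Q_j\ne\emptyset\}$ one has $\sup_i|i^*|<\infty$ and $\sup_i\sup_{j\in i^*}\|T_i^{-1}T_j\|<\infty$; $\bigcup_iQ_i'$ is bounded; and there is $\varepsilon>0$ such that each $Q_i'$ contains a ball of radius $\varepsilon$. Here $\|\cdot\|$ is the operator norm for the Euclidean norm $|\cdot|$. Assume that $\mathcal Q$ is an $L^p$-decomposition covering, i.e. it has an $L^p$-BAPU $\Phi=(\varphi_i)_{i\in I}$: $\varphi_i\in C_c^\infty(\mathcal O)$ (complex-valued), $\varphi_i=0$ off $Q_i$, $\sum_i\varphi_i=1$ on $\mathcal O$, and $\sup_i\|\mathcal F^{-1}\varphi_i\|_{L^1}<\infty$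 if $p\ge1$, respectively $\sup_i|\det T_i|^{\frac1p-1}\|\mathcal F^{-1}\varphi_i\|_{L^p}<\infty$ if $p<1$, where $\mathcal Ff(\xi)=\widehat f(\xi)=\int f(x)e^{-2\pi i\langle x,\xi\rangle}\,dx$. Fix such a $\Phi$. Let $Y\le\mathbb C^I$ be a $\mathcal Q$-regular sequence space: a complete quasi-normed space of sequences that is solid (if $y\in Y$ and $|x_i|\le|y_i|$ for all $i$, then $x\in Y$ and $\|x\|_Y\le\|y\|_Y$) and for which $(x_i)_i\mapsto(\sum_{\ell\in i^*}x_\ell)_i$ is a well-defined bounded map $Y\to Y$. Let $\mathcal S_{\mathcal O}^{p,Y}$ be the space of all Schwartz functions $f$ with $\widehat f\in C_c^\infty(\mathcal O)$ and $$\|f\|_{\mathcal D(\mathcal Q,L^p,Y)}:=\Big\|\big(\|\mathcal F^{-1}(\varphi_i\widehat f\,)\|_{L^p}\big)_{i\in I}\Big\|_Y<\infty$$ (the norm is $\infty$ if the sequence has an infinite entry or is not in $Y$). Assume that for every $\alpha\in\mathbb N_0^d$ with $|\alpha|=k$ the map $\mathcal S_{\mathcal O}^{p,Y}\to L^q(\mathbb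 R^d)$, $f\mapsto\partial^\alpha f$, is bounded. For $r\in(0,\infty]$ put $u^{(k,p,r)}_i:=|\det T_i|^{\frac1p-\frac1r}\,(|b_i|^k+\|T_i\|^k)$, and for a weight $u$ let $\ell^r_u(I)$ be the space of all $x\in\mathbb C^I$ with $\|x\|_{\ell^r_u}:=\|(u_ix_i)_i\|_{\ell^r}<\infty$. For $J\subset I$ let $\ell_0(J)$ be the space of finitely supported sequences on $I$ vanishing off $J$. Write $Y\cap\ell_0(J)\hookrightarrow\ell^r_u(I)$ if there is $C\ge 0$ with $\|c\|_{\ell^r_u}\le C\|c\|_Y<\infty$ for all $c\in Y\cap\ell_0(J)$. Then: 1. $Y\cap\ell_0(I)\hookrightarrow\ell^q_{u^{(k,p,q)}}(I)$. 2. If $q=\infty$, then $Y\cap\ell_0(I)\hookrightarrow\ell^1_{u^{(k,p,q)}}(I)$. 3. For each $I^{(0)}\subset I$ and each $M>0$ with $\|T_i^{-1}\|\le M$ for all $i\in I^{(0)}$: (a) if $q\in[2,\infty)$, then $Y\cap\ell_0(I^{(0)})\hookrightarrow\ell^2_{u^{(k,p,2)}}(I)$; (b) if $q\in(0,\infty)$,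 then $Y\cap\ell_0(I^{(0)})\hookrightarrow\ell^2_{u^{(k,p,p)}}(I)$. -/

import Mathlib

open MeasureTheory Set Filter Topology
open scoped ENNReal NNReal Distributions FourierTransform SchwartzMap LineDeriv

noncomputable section

namespace Decomp

/-- The Euclidean space `ℝ^d`. -/
abbrev E (d : ℕ) : Type := EuclideanSpace ℝ (Fin d)

/-- A family of sets `Q_i = T_i Q_i' + b_i` in `ℝ^d`, with `T_i ∈ GL(ℝ^d)` and `b_i ∈ ℝ^d`. -/
structure AffineFamily (d : ℕ) (I : Type*) where
  /-- the invertible linear maps `T_i` -/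
  T : I → (E d ≃L[ℝ] E d)
  /-- the shifts `b_i` -/
  b : I → E d
  /-- the normalized sets `Q_i'` -/
  Q' : I → Set (E d)

namespace AffineFamily

variable {d : ℕ} {I : Type*} (𝒬 : AffineFamily d I)

/-- `Q_i = T_i Q_i' + b_i`. -/
def Q (i : I) : Set (E d) := (fun x => 𝒬.T i x + 𝒬.b i) '' 𝒬.Q' i

/-- The set `i^*` of neighbours of the index `i`. -/
def nbr (i : I) : Set I := {j | (𝒬.Q i ∩ 𝒬.Q j).Nonempty}

/-- `‖T_i‖`, the operator norm for the Euclidean norm. -/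
def normT (i : I) : ℝ := ‖(𝒬.T i : E d →L[ℝ] E d)‖

/-- `‖T_i⁻¹‖`. -/
def normTinv (i : I) : ℝ := ‖((𝒬.T i).symm : E d →L[ℝ] E d)‖

/-- `|det T_i|`. -/
def absDet (i : I) : ℝ := |LinearMap.det ((𝒬.T i).toLinearEquiv : E d →ₗ[ℝ] E d)|

/-- The family is a covering of `O`, i.e. `⋃ i, Q_i = O`. -/
def IsCoveringOf (O : Set (E d)) : Prop := ⋃ i, 𝒬.Q i = O

/-- Admissibility: all `Q_i` are nonempty and `sup_i |i^*| < ∞`. -/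
def IsAdmissible : Prop :=
  (∀ i, (𝒬.Q i).Nonempty) ∧ ∃ N : ℕ, ∀ i, (𝒬.nbr i).encard ≤ N

/-- Semi-structured coverings. -/
structure IsSemiStructured (O : Set (E d)) : Prop where
  covers : 𝒬.IsCoveringOf O
  admissible : 𝒬.IsAdmissible
  bounded : Bornology.IsBounded (⋃ i, 𝒬.Q' i)
  compatible : ∃ C : ℝ, ∀ i, ∀ j ∈ 𝒬.nbr i,
    ‖((𝒬.T i).symm : E d →L[ℝ] E d) ∘L (𝒬.T j : E d →L[ℝ] E d)‖ ≤ C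

/-- Tightness: the sets `Q_i'` contain balls of a fixed positive radius. -/
def IsTight : Prop := ∃ ε > 0, ∀ i, ∃ c : E d, Metric.ball c ε ⊆ 𝒬.Q' i

/-- `φ` is a partition of unity in `C_c^∞(O)` subordinate to the covering. -/
structure IsPartitionOfUnity {O : TopologicalSpace.Opens (E d)} (φ : I → 𝓓(O, ℂ)) : Prop where
  eq_zero : ∀ i, ∀ x ∉ 𝒬.Q i, φ i x = 0
  sum_eq_one : ∀ x ∈ O, HasSum (fun i => φ i x) 1

/-- `φ` is an `L^p`-BAPU (bounded admissible partition of unity) for the covering. -/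
structure IsBAPU {O : TopologicalSpace.Opens (E d)} (p : ℝ≥0∞) (φ : I → 𝓓(O, ℂ)) : Prop where
  partition : 𝒬.IsPartitionOfUnity φ
  bound_of_one_le : 1 ≤ p → ∃ C : ℝ≥0, ∀ i,
    eLpNorm (𝓕⁻ (φ i : E d → ℂ)) 1 volume ≤ C
  bound_of_lt_one : p < 1 → ∃ C : ℝ≥0, ∀ i,
    ENNReal.ofReal (𝒬.absDet i ^ (1 / p.toReal - 1)) *
      eLpNorm (𝓕⁻ (φ i : E d → ℂ)) p volume ≤ C

/-- The weight `u^{(k,p,q)}_i = |det T_i|^{1/p - 1/q} (|b_i|^k + ‖T_i‖^k)`, where `1/∞ = 0`. -/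
def weight (k : ℕ) (p q : ℝ≥0∞) (i : I) : ℝ :=
  𝒬.absDet i ^ ((1 / p).toReal - (1 / q).toReal) * (‖𝒬.b i‖ ^ k + 𝒬.normT i ^ k)

end AffineFamily

/-- A solid quasi-Banach space of complex sequences over `I`. -/
structure SequenceSpace (I : Type*) where
  /-- the underlying subspace of `ℂ^I` -/
  carrier : Submodule ℂ (I → ℂ)
  /-- the quasi-norm -/
  qnorm : carrier → ℝ
  qnorm_nonneg : ∀ x, 0 ≤ qnorm x
  qnorm_eq_zero_iff : ∀ x, qnorm x = 0 ↔ x = 0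
  qnorm_smul : ∀ (a : ℂ) (x : carrier), qnorm (a • x) = ‖a‖ * qnorm x
  qnorm_add_le : ∃ C : ℝ, 1 ≤ C ∧ ∀ x y, qnorm (x + y) ≤ C * (qnorm x + qnorm y)
  complete : ∀ s : ℕ → carrier,
    (∀ ε > 0, ∃ N, ∀ m ≥ N, ∀ n ≥ N, qnorm (s m - s n) < ε) →
      ∃ x, Tendsto (fun n => qnorm (s n - x)) atTop (𝓝 0)
  solid : ∀ (x : I → ℂ) (y : carrier), (∀ i, ‖x i‖ ≤ ‖(y : I → ℂ) i‖) →
    ∃ hx : x ∈ carrier, qnorm ⟨x, hx⟩ ≤ qnorm y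

namespace SequenceSpace

variable {d : ℕ} {I : Type*} (Y : SequenceSpace I)

/-- `𝒬`-regularity: the clustering map `x ↦ (∑_{ℓ ∈ i^*} x_ℓ)_i` maps `Y` boundedly to `Y`. -/
def IsRegular (𝒬 : AffineFamily d I) : Prop :=
  ∃ C : ℝ, ∀ x : Y.carrier, ∃ h : (fun i => ∑ᶠ l ∈ 𝒬.nbr i, (x : I → ℂ) l) ∈ Y.carrier,
    Y.qnorm ⟨_, h⟩ ≤ C * Y.qnorm x

open scoped Classical in
/-- `‖c‖_Y` for a sequence `c` with values in `[0,∞]`; it is `∞` if `c_i = ∞` for some `i` or if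
`c ∉ Y`. -/
def extNorm (c : I → ℝ≥0∞) : ℝ≥0∞ :=
  if h : (∀ i, c i ≠ ∞) ∧ (fun i => ((c i).toReal : ℂ)) ∈ Y.carrier then
    ENNReal.ofReal (Y.qnorm ⟨_, h.2⟩)
  else ∞

end SequenceSpace

/-- The `ℓ^r` (quasi-)norm, `0 < r ≤ ∞`, with values in `[0,∞]`. -/
def seqNorm {I : Type*} (r : ℝ≥0∞) (x : I → ℂ) : ℝ≥0∞ :=
  if r = ∞ then ⨆ i, ‖x i‖ₑ else (∑' i, ‖x i‖ₑ ^ r.toReal) ^ (1 / r.toReal)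

/-- The norm of the weighted space `ℓ^r_u(I)`; a sequence lies in that space iff it is finite. -/
def weightedSeqNorm {I : Type*} (u : I → ℝ) (r : ℝ≥0∞) (x : I → ℂ) : ℝ≥0∞ :=
  seqNorm r (fun i => (u i : ℂ) * x i)

/-- The identity is a well-defined bounded map `Y ∩ ℓ_0(J) → ℓ^r_u(I)`, where `ℓ_0(J)` are the
finitely supported sequences on `I` that vanish outside of `J ⊆ I`. -/
def FinSuppEmbeds {I : Type*} (Y : SequenceSpace I) (J : Set I) (u : I → ℝ) (r : ℝ≥0∞) : Prop :=
  ∃ C : ℝ≥0, ∀ c : Y.carrier, (Function.support (c : I → ℂ)).Finite →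
    Function.support (c : I → ℂ) ⊆ J →
      weightedSeqNorm u r c < ∞ ∧ weightedSeqNorm u r c ≤ C * ENNReal.ofReal (Y.qnorm c)

/-- The space `𝓓'(O)` of (complex) distributions on `O`. -/
abbrev Distr {d : ℕ} (O : TopologicalSpace.Opens (E d)) : Type := 𝓓(O, ℂ) →L[ℂ] ℂ

/-- The test function `ξ ↦ φ(ξ) e^{2πi⟨x,ξ⟩}`. -/
def modulate {d : ℕ} {O : TopologicalSpace.Opens (E d)} (φ : 𝓓(O, ℂ)) (x : E d) : 𝓓(O, ℂ) where
  toFun ξ := φ ξ * Complex.exp (2 * Real.pi * Complex.I * (inner ℝ x ξ : ℝ))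
  contDiff' := by
    refine φ.contDiff.mul (ContDiff.cexp (contDiff_const.mul ?_))
    exact Complex.ofRealCLM.contDiff.comp (contDiff_const.inner ℝ contDiff_id)
  hasCompactSupport' := φ.hasCompactSupport.mul_right
  tsupport_subset' := (tsupport_mul_subset_left).trans φ.tsupport_subset

/-- For a distribution `g` on `O` and `φ ∈ C_c^∞(O)`, the (Paley–Wiener) smooth function
`𝓕⁻¹(φ g)`, i.e. `x ↦ ⟨g, φ e^{2πi⟨x,·⟩}⟩`. -/
def localPiece {d : ℕ} {O : TopologicalSpace.Opens (E d)} (φ : 𝓓(O, ℂ)) (g : Distr O) :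
    E d → ℂ := fun x => g (modulate φ x)

/-- The Fourier-side decomposition space quasi-norm
`‖ (‖𝓕⁻¹(φ_i g)‖_{L^p})_i ‖_Y` of a distribution `g` on `O`. -/
def fourierSideNorm {d : ℕ} {I : Type*} {O : TopologicalSpace.Opens (E d)} (φ : I → 𝓓(O, ℂ))
    (p : ℝ≥0∞) (Y : SequenceSpace I) (g : Distr O) : ℝ≥0∞ :=
  Y.extNorm (fun i => eLpNorm (localPiece (φ i) g) p volume)

/-- The Fourier transform of `f ∈ 𝓢(ℝ^d)` as a distribution on `O`, i.e. integration against the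
function `𝓕 f`. -/
def fourierDistr {d : ℕ} (O : TopologicalSpace.Opens (E d)) (f : 𝓢(E d, ℂ)) : Distr O :=
  TestFunction.integralAgainstBilinCLM (ContinuousLinearMap.mul ℂ ℂ) volume (𝓕 f : 𝓢(E d, ℂ))

/-- The decomposition space quasi-norm `‖f‖_{𝓓(𝒬, L^p, Y)} = ‖𝓕 f‖_{𝓓_𝓕(𝒬, L^p, Y)}` of a Schwartz
function, computed with the `L^p`-BAPU `φ`. -/
def decompNorm {d : ℕ} {I : Type*} {O : TopologicalSpace.Opens (E d)} (φ : I → 𝓓(O, ℂ))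
    (p : ℝ≥0∞) (Y : SequenceSpace I) (f : 𝓢(E d, ℂ)) : ℝ≥0∞ :=
  fourierSideNorm φ p Y (fourierDistr O f)

/-- `𝓢_O(ℝ^d)`: the Schwartz functions whose Fourier transform lies in `C_c^∞(O)`. -/
def schwartzO {d : ℕ} (O : TopologicalSpace.Opens (E d)) : Set 𝓢(E d, ℂ) :=
  {f | HasCompactSupport (𝓕 f : 𝓢(E d, ℂ)) ∧ tsupport (𝓕 f : 𝓢(E d, ℂ)) ⊆ O}

/-- `𝓢_O^{p,Y}(ℝ^d) = 𝓢_O(ℝ^d) ∩ 𝓓(𝒬, L^p, Y)`. -/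
def schwartzOpY {d : ℕ} {I : Type*} {O : TopologicalSpace.Opens (E d)} (φ : I → 𝓓(O, ℂ))
    (p : ℝ≥0∞) (Y : SequenceSpace I) : Set 𝓢(E d, ℂ) :=
  schwartzO O ∩ {f | decompNorm φ p Y f < ∞}

/-- The partial derivative `∂^α f = ∂_1^{α_1} ⋯ ∂_d^{α_d} f` of a Schwartz function. -/
def multiDeriv {d : ℕ} (α : Fin d → ℕ) (f : 𝓢(E d, ℂ)) : 𝓢(E d, ℂ) :=
  (List.finRange d).foldr (fun j g => (∂_{(EuclideanSpace.single j (1 : ℝ) : E d)})^[α j] g) f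

/-- The map `𝓢_O^{p,Y}(ℝ^d) → L^q(ℝ^d)`, `f ↦ ∂^α f`, is bounded. -/
def DerivBounded {d : ℕ} {I : Type*} {O : TopologicalSpace.Opens (E d)} (φ : I → 𝓓(O, ℂ))
    (p q : ℝ≥0∞) (Y : SequenceSpace I) (α : Fin d → ℕ) : Prop :=
  ∃ C : ℝ≥0, ∀ f ∈ schwartzOpY φ p Y,
    eLpNorm (multiDeriv α f) q volume ≤ C * decompNorm φ p Y f

end Decomp

end

/-! The hypothesis is tested on finite sums `∑ a_l g_l` of `L^p`-normalized atoms. The Fourier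
transform of `g_l` is a fixed bump, transported by an affine map `η ↦ A_l η + ζ_l` into `Q_l` and
modulated so that `g_l` is centred at a freely chosen point `x_l`.

Upper bound (`exists_decompNorm_sum_le`): in `𝓕⁻(φ_i f̂)` only the boundedly many neighbours `l ∈
i^*` contribute, each with `L^p` norm at most a constant times `|a_l|`; solidity and regularity of
`Y` then bound the norm of the sum by `‖c‖_Y` whenever `|a_l| ≤ |c_l|`. For `p < 1`, Young's
inequality is replaced by a convolution inequality for band-limited functions, whose volume factor
`|det T_i|^{1/p-1}` is the one built into the BAPU condition.

Lower bound (`FitsInto.le_norm_multiDeriv`): tightness lets the bump sit where some coordinate `ξ_j`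
has constant sign and modulus at least `W_l ≈ |b_l| + ‖T_l‖`. Hence the integral for `∂_j^k g_l` has
no cancellation near `x_l`, and `|∂_j^k g_l| ≳ |det A_l|^{1/p} W_l^k` on a "core" ellipsoid about
`x_l` of volume `≈ |det A_l|⁻¹`. The index `j` depends on `l`, so sums are split into `d` classes.

For `q = ∞`, aligning the phases of all terms at one point gives `ℓ¹`, hence also `ℓ^∞`. For `q <
∞`, averaging over random signs (Khintchine) puts the square function of the core bounds in `L^q`
(`exists_lintegral_squareFunction_le`). Disjoint cores give `ℓ^q`. If `‖T_l⁻¹‖ ≤ M`, cores centred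
at `0` lie in one ball, where `L^q ⊂ L²` for `q ≥ 2`; this gives the weight `u^{(k,p,2)}`. Taking
the single map `A = M⁻¹ · id` for all `l` makes the cores coincide and gives the weight
`u^{(k,p,p)}` for every finite `q`. -/

noncomputable section

namespace Decomp

/-! ### Random signs and Khintchine's inequality. -/

section Khintchine

variable {ι : Type*}

open scoped Classical in
/-- The sum `∑_{l ∈ S} ± a_l`, where the sign is `+` exactly if `l ∈ t`. -/
def signedSum (S t : Finset ι) (a : ι → ℂ) : ℂ := ∑ l ∈ S, if l ∈ t then a l else -a l

-- Conditioning on the sign of the new term; this drives the inductions for both moments.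
open scoped Classical in
lemma sum_powerset_signedSum_insert (S : Finset ι) {m : ι} (hm : m ∉ S) (a : ι → ℂ)
    (f : ℂ → ℝ) :
    ∑ t ∈ (insert m S).powerset, f (signedSum (insert m S) t a) =
      ∑ t ∈ S.powerset, (f (signedSum S t a - a m) + f (signedSum S t a + a m)) := by
  rw [Finset.sum_powerset_insert hm, ← Finset.sum_add_distrib]
  refine Finset.sum_congr rfl fun t ht => ?_
  have hmt : m ∉ t := fun h => hm (Finset.mem_powerset.1 ht h)
  have h1 : signedSum (insert m S) t a = signedSum S t a - a m := by
    simp only [signedSum, Finset.sum_insert hm, if_neg hmt]; ring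
  have h2 : signedSum (insert m S) (insert m t) a = signedSum S t a + a m := by
    simp only [signedSum, Finset.sum_insert hm, Finset.mem_insert_self, if_true]
    rw [add_comm]
    congr 1
    refine Finset.sum_congr rfl fun l hl => ?_
    have : l ≠ m := fun h => hm (h ▸ hl)
    simp [Finset.mem_insert, this]
  rw [h1, h2]

/-- Cross terms cancel by the parallelogram law, so the average is exactly the sum of squares. -/
lemma sum_norm_sq_signedSum (S : Finset ι) (a : ι → ℂ) :
    ∑ t ∈ S.powerset, ‖signedSum S t a‖ ^ 2 = 2 ^ S.card * ∑ l ∈ S, ‖a l‖ ^ 2 := by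
  classical
  induction S using Finset.induction_on with
  | empty => simp [signedSum]
  | insert m S hm ih =>
    rw [sum_powerset_signedSum_insert S hm a (fun z => ‖z‖ ^ 2), Finset.card_insert_of_notMem hm,
      Finset.sum_insert hm]
    have h : ∀ z : ℂ, ‖z - a m‖ ^ 2 + ‖z + a m‖ ^ 2 = 2 * ‖z‖ ^ 2 + 2 * ‖a m‖ ^ 2 := by
      intro z
      simp only [← Complex.normSq_eq_norm_sq, Complex.normSq_apply, Complex.add_re, Complex.add_im,
        Complex.sub_re, Complex.sub_im]
      ring
    simp only [h, Finset.sum_add_distrib, ← Finset.mul_sum, ih, Finset.sum_const,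
      Finset.card_powerset, nsmul_eq_mul]
    push_cast
    ring

lemma sum_norm_pow_four_signedSum (S : Finset ι) (a : ι → ℂ) :
    ∑ t ∈ S.powerset, ‖signedSum S t a‖ ^ 4 ≤ 2 ^ S.card * (3 * (∑ l ∈ S, ‖a l‖ ^ 2) ^ 2) := by
  classical
  induction S using Finset.induction_on with
  | empty => simp [signedSum]
  | insert m S hm ih =>
    rw [sum_powerset_signedSum_insert S hm a (fun z => ‖z‖ ^ 4), Finset.card_insert_of_notMem hm,
      Finset.sum_insert hm]
    -- The left side is `2(|z|² + |a|²)² + 8 (Re z ā)²`; the square passed to `nlinarith` is the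
    -- defect in `(Re z ā)² ≤ |z|²|a|²`.
    have h : ∀ z : ℂ, ‖z - a m‖ ^ 4 + ‖z + a m‖ ^ 4 ≤
        2 * ‖z‖ ^ 4 + 12 * ‖a m‖ ^ 2 * ‖z‖ ^ 2 + 2 * ‖a m‖ ^ 4 := by
      intro z
      have e : ∀ w : ℂ, ‖w‖ ^ 4 = (w.re * w.re + w.im * w.im) ^ 2 := fun w => by
        rw [← Complex.normSq_apply, Complex.normSq_eq_norm_sq]; ring
      have e2 : ∀ w : ℂ, ‖w‖ ^ 2 = (w.re * w.re + w.im * w.im) := fun w => by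
        rw [← Complex.normSq_apply, Complex.normSq_eq_norm_sq]
      simp only [e, e2, Complex.add_re, Complex.add_im, Complex.sub_re, Complex.sub_im]
      nlinarith [sq_nonneg (z.re * (a m).im - z.im * (a m).re)]
    calc _ ≤ ∑ t ∈ S.powerset, (2 * ‖signedSum S t a‖ ^ 4 +
            12 * ‖a m‖ ^ 2 * ‖signedSum S t a‖ ^ 2 + 2 * ‖a m‖ ^ 4) :=
          Finset.sum_le_sum fun t _ => h _
      _ = 2 * (∑ t ∈ S.powerset, ‖signedSum S t a‖ ^ 4) +
            12 * ‖a m‖ ^ 2 * (2 ^ S.card * ∑ l ∈ S, ‖a l‖ ^ 2) +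
            2 ^ S.card * (2 * ‖a m‖ ^ 4) := by
          rw [← sum_norm_sq_signedSum]
          simp only [Finset.sum_add_distrib, ← Finset.mul_sum, Finset.sum_const,
            Finset.card_powerset, nsmul_eq_mul]
          push_cast
          ring
      _ ≤ _ := by
          have : (0:ℝ) ≤ 2 ^ S.card * ‖a m‖ ^ 4 := by positivity
          rw [pow_succ (2 : ℝ) S.card]
          nlinarith

/-- The lower Khintchine inequality. -/
theorem exists_khintchine {q : ℝ} (hq : 0 < q) : ∃ c : ℝ, 0 < c ∧
    ∀ (S : Finset ι) (a : ι → ℂ), 2 ^ S.card * (c * (∑ l ∈ S, ‖a l‖ ^ 2) ^ (q / 2)) ≤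
      ∑ t ∈ S.powerset, ‖signedSum S t a‖ ^ q := by
  rcases le_total 2 q with h2 | h2
  · refine ⟨(1 / 2) ^ (q / 2 - 1) * (1 / 2), by positivity, fun S a => ?_⟩
    set σ := ∑ l ∈ S, ‖a l‖ ^ 2 with hσ
    have hσ0 : 0 ≤ σ := Finset.sum_nonneg fun _ _ => by positivity
    rcases hσ0.eq_or_lt with h0 | h0
    · rw [← h0, Real.zero_rpow (by positivity)]
      simp only [mul_zero]
      exact Finset.sum_nonneg fun _ _ => by positivity
    -- A minorant of `x^q` affine in `x²`, so the second moment suffices. The threshold `σ / 2` is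
    -- half the mean square, so half of the mean survives averaging.
    have pt : ∀ x : ℝ, 0 ≤ x → (σ / 2) ^ (q / 2 - 1) * (x ^ 2 - σ / 2) ≤ x ^ q := by
      intro x hx
      rcases le_total (x ^ 2) (σ / 2) with h | h
      · exact (mul_nonpos_of_nonneg_of_nonpos (by positivity) (by linarith)).trans (by positivity)
      · have hx0 : 0 < x := by
          rcases hx.eq_or_lt with h' | h'
          · rw [← h'] at h; norm_num at h; linarith
          · exact h'
        calc (σ / 2) ^ (q / 2 - 1) * (x ^ 2 - σ / 2) ≤ (x ^ 2) ^ (q / 2 - 1) * x ^ 2 := by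
              gcongr
              · linarith
              · linarith
          _ = x ^ q := by
              rw [← Real.rpow_natCast x 2, ← Real.rpow_mul hx, ← Real.rpow_add hx0]
              congr 1; push_cast; ring
    calc 2 ^ S.card * ((1 / 2) ^ (q / 2 - 1) * (1 / 2) * σ ^ (q / 2))
        = (σ / 2) ^ (q / 2 - 1) * (2 ^ S.card * σ - 2 ^ S.card * (σ / 2)) := by
          rw [show σ / 2 = (1 / 2) * σ by ring, Real.mul_rpow (by norm_num) hσ0,
            Real.rpow_sub_one h0.ne']
          field_simp
          ring
      _ = ∑ t ∈ S.powerset, (σ / 2) ^ (q / 2 - 1) * (‖signedSum S t a‖ ^ 2 - σ / 2) := by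
          rw [← Finset.mul_sum, Finset.sum_sub_distrib, sum_norm_sq_signedSum, ← hσ]
          simp [Finset.card_powerset]
      _ ≤ _ := Finset.sum_le_sum fun t _ => pt _ (norm_nonneg _)
  · refine ⟨6 ^ (q / 2 - 1) * (1 / 2), by positivity, fun S a => ?_⟩
    set σ := ∑ l ∈ S, ‖a l‖ ^ 2 with hσ
    have hσ0 : 0 ≤ σ := Finset.sum_nonneg fun _ _ => by positivity
    rcases hσ0.eq_or_lt with h0 | h0
    · rw [← h0, Real.zero_rpow (by positivity)]
      simp only [mul_zero]
      exact Finset.sum_nonneg fun _ _ => by positivity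
    -- For `q ≤ 2` large values must be penalised by the fourth moment. Since that moment is at most
    -- `3σ²` on average, the choice `6σ` leaves `σ - 3σ²/(6σ) = σ/2`.
    have pt : ∀ x : ℝ, 0 ≤ x → (6 * σ) ^ (q / 2 - 1) * (x ^ 2 - x ^ 4 / (6 * σ)) ≤ x ^ q := by
      intro x hx
      rcases hx.eq_or_lt with h' | hx0
      · rw [← h']; simp [Real.zero_rpow hq.ne']
      have h4 : x ^ 4 = x ^ 2 * x ^ 2 := by ring
      rcases le_total (6 * σ) (x ^ 2) with h | h
      · refine (mul_nonpos_of_nonneg_of_nonpos (by positivity) ?_).trans (by positivity)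
        rw [sub_nonpos, le_div_iff₀ (by positivity), h4]
        gcongr
      · calc (6 * σ) ^ (q / 2 - 1) * (x ^ 2 - x ^ 4 / (6 * σ)) ≤ (x ^ 2) ^ (q / 2 - 1) * x ^ 2 := by
              refine mul_le_mul ?_ ?_ ?_ (by positivity)
              · exact Real.rpow_le_rpow_of_nonpos (by positivity) h (by linarith)
              · have : 0 ≤ x ^ 4 / (6 * σ) := by positivity
                linarith
              · rw [sub_nonneg, div_le_iff₀ (by positivity), h4]
                gcongr
          _ = x ^ q := by
              rw [← Real.rpow_natCast x 2, ← Real.rpow_mul hx, ← Real.rpow_add hx0]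
              congr 1; push_cast; ring
    calc 2 ^ S.card * (6 ^ (q / 2 - 1) * (1 / 2) * σ ^ (q / 2))
        = (6 * σ) ^ (q / 2 - 1) * (2 ^ S.card * σ - 2 ^ S.card * (3 * σ ^ 2) / (6 * σ)) := by
          rw [Real.mul_rpow (by norm_num) hσ0, Real.rpow_sub_one h0.ne']
          field_simp
          ring
      _ ≤ (6 * σ) ^ (q / 2 - 1) * (∑ t ∈ S.powerset, ‖signedSum S t a‖ ^ 2 -
            (∑ t ∈ S.powerset, ‖signedSum S t a‖ ^ 4) / (6 * σ)) := by
          rw [sum_norm_sq_signedSum]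
          gcongr
          exact sum_norm_pow_four_signedSum S a
      _ = ∑ t ∈ S.powerset, (6 * σ) ^ (q / 2 - 1) *
            (‖signedSum S t a‖ ^ 2 - ‖signedSum S t a‖ ^ 4 / (6 * σ)) := by
          rw [← Finset.mul_sum, Finset.sum_sub_distrib, Finset.sum_div]
      _ ≤ _ := Finset.sum_le_sum fun t _ => pt _ (norm_nonneg _)

end Khintchine

/-! ### Convolution inequalities in `L^p`, including `p < 1`. -/

section Convolution

variable {d : ℕ}

/-- The set where the bound holds is closed and of full measure, hence dense, hence everything. -/
lemma enorm_le_eLpNorm_top {f : E d → ℂ} (hf : Continuous f) (x : E d) :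
    ‖f x‖ₑ ≤ eLpNorm f ∞ volume := by
  have h : ∀ᵐ y ∂(volume : Measure (E d)), y ∈ {y | ‖f y‖ₑ ≤ eLpNorm f ∞ volume} := by
    simpa using enorm_ae_le_eLpNormEssSup f volume
  have hc : IsClosed {y | ‖f y‖ₑ ≤ eLpNorm f ∞ volume} :=
    isClosed_le hf.enorm continuous_const
  have : closure {y | ‖f y‖ₑ ≤ eLpNorm f ∞ volume} = univ := (Measure.dense_of_ae h).closure_eq
  rw [hc.closure_eq] at this
  exact (this ▸ mem_univ x : x ∈ {y | ‖f y‖ₑ ≤ eLpNorm f ∞ volume})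

/-- Young's inequality `L^1 * L^p ⊆ L^p` for nonnegative functions. -/
lemma lintegral_rpow_lconvolution_le {u v : E d → ℝ≥0∞} (hu : Measurable u) (hv : Measurable v)
    {p : ℝ} (hp : 1 ≤ p) :
    ∫⁻ x, (∫⁻ y, u y * v (x - y)) ^ p ≤ (∫⁻ y, u y) ^ p * ∫⁻ x, v x ^ p := by
  have hp0 : 0 < p := by linarith
  have h1 : 0 ≤ 1 - 1 / p := by
    rw [sub_nonneg, div_le_iff₀ hp0]; linarith
  have pt : ∀ x, (∫⁻ y, u y * v (x - y)) ^ p ≤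
      (∫⁻ y, u y) ^ (p - 1) * ∫⁻ y, u y * v (x - y) ^ p := by
    intro x
    have hvx : Measurable fun y => v (x - y) := hv.comp (measurable_const.sub measurable_id)
    -- Hölder with weights `1 - 1/p` and `1/p` for this factorisation is Jensen's inequality for the
    -- measure `u dy`; Tonelli then finishes.
    have e : ∀ y, u y * v (x - y) = u y ^ (1 - 1 / p) * (u y * v (x - y) ^ p) ^ (1 / p) := by
      intro y
      rw [ENNReal.mul_rpow_of_nonneg _ _ (by positivity), ← mul_assoc,
        ← ENNReal.rpow_add_of_nonneg _ _ h1 (by positivity), ← ENNReal.rpow_mul]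
      simp [hp0.ne']
    calc (∫⁻ y, u y * v (x - y)) ^ p
        = (∫⁻ y, u y ^ (1 - 1 / p) * (u y * v (x - y) ^ p) ^ (1 / p)) ^ p := by simp_rw [← e]
      _ ≤ ((∫⁻ y, u y) ^ (1 - 1 / p) * (∫⁻ y, u y * v (x - y) ^ p) ^ (1 / p)) ^ p := by
          gcongr
          exact ENNReal.lintegral_mul_norm_pow_le hu.aemeasurable
            (hu.mul (hvx.pow_const p)).aemeasurable h1 (by positivity) (by ring)
      _ = _ := by
          rw [ENNReal.mul_rpow_of_nonneg _ _ hp0.le, ← ENNReal.rpow_mul, ← ENNReal.rpow_mul]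
          congr 2
          · field_simp
          · rw [one_div_mul_cancel hp0.ne', ENNReal.rpow_one]
  calc _ ≤ ∫⁻ x, (∫⁻ y, u y) ^ (p - 1) * ∫⁻ y, u y * v (x - y) ^ p := lintegral_mono pt
    _ = (∫⁻ y, u y) ^ (p - 1) * ∫⁻ x, ∫⁻ y, u y * v (x - y) ^ p := by
        rw [lintegral_const_mul]
        exact Measurable.lintegral_prod_right' (f := fun z : E d × E d => u z.2 * v (z.1 - z.2) ^ p)
          (by fun_prop)
    _ = (∫⁻ y, u y) ^ (p - 1) * ∫⁻ y, ∫⁻ x, u y * v (x - y) ^ p := by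
        rw [lintegral_lintegral_swap]
        exact Measurable.aemeasurable (by fun_prop)
    _ = (∫⁻ y, u y) ^ (p - 1) * ((∫⁻ y, u y) * ∫⁻ x, v x ^ p) := by
        congr 1
        rw [← lintegral_mul_const _ hu]
        refine lintegral_congr fun y => ?_
        rw [lintegral_const_mul _ (by fun_prop)]
        rw [lintegral_sub_right_eq_self (fun x => v x ^ p) y]
    _ = _ := by
        rw [← mul_assoc]
        congr 1
        nth_rw 2 [← ENNReal.rpow_one (∫⁻ y, u y)]
        rw [← ENNReal.rpow_add_of_nonneg _ _ (by linarith) zero_le_one]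
        congr 1; ring

lemma enorm_convolution_le (F g : E d → ℂ) (x : E d) :
    ‖∫ y, F y * g (x - y)‖ₑ ≤ ∫⁻ y, ‖F y‖ₑ * ‖g (x - y)‖ₑ := by
  refine (enorm_integral_le_lintegral_enorm _).trans (le_of_eq ?_)
  simp [enorm_mul]

lemma eLpNorm_convolution_le_of_one_le {F g : E d → ℂ} (hF : Continuous F) (hg : Continuous g)
    {p : ℝ≥0∞} (hp : 1 ≤ p) :
    eLpNorm (fun x => ∫ y, F y * g (x - y)) p volume ≤
      eLpNorm F 1 volume * eLpNorm g p volume := by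
  rcases eq_or_ne p ∞ with rfl | hpt
  · rw [eLpNorm_exponent_top]
    refine eLpNormEssSup_le_of_ae_enorm_bound (Eventually.of_forall fun x => ?_)
    refine (enorm_convolution_le F g x).trans ?_
    rw [eLpNorm_one_eq_lintegral_enorm, ← lintegral_mul_const _ hF.enorm.measurable]
    exact lintegral_mono fun y => by gcongr; exact enorm_le_eLpNorm_top hg _
  · have hp0 : p ≠ 0 := (zero_lt_one.trans_le hp).ne'
    have hpr : 1 ≤ p.toReal := by
      simpa using (ENNReal.toReal_le_toReal ENNReal.one_ne_top hpt).2 hp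
    rw [eLpNorm_eq_lintegral_rpow_enorm_toReal hp0 hpt, eLpNorm_one_eq_lintegral_enorm,
      eLpNorm_eq_lintegral_rpow_enorm_toReal hp0 hpt]
    calc _ ≤ (∫⁻ x, (∫⁻ y, ‖F y‖ₑ * ‖g (x - y)‖ₑ) ^ p.toReal) ^ (1 / p.toReal) := by
          gcongr with x
          exact enorm_convolution_le F g x
      _ ≤ ((∫⁻ y, ‖F y‖ₑ) ^ p.toReal * ∫⁻ x, ‖g x‖ₑ ^ p.toReal) ^ (1 / p.toReal) := by
          gcongr
          exact lintegral_rpow_lconvolution_le hF.enorm.measurable hg.enorm.measurable hpr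
      _ = _ := by
          rw [ENNReal.mul_rpow_of_nonneg _ _ (by positivity), ← ENNReal.rpow_mul,
            mul_one_div_cancel (by positivity), ENNReal.rpow_one]

/-- An elementary Nikolskii inequality: a function whose Fourier transform vanishes outside of `B`
is bounded by its `L^1` norm times the measure of `B`. -/
lemma enorm_le_measure_mul_lintegral (h : 𝓢(E d, ℂ)) {B : Set (E d)}
    (hs : ∀ ξ ∉ B, (𝓕⁻ h : 𝓢(E d, ℂ)) ξ = 0) (y : E d) :
    ‖h y‖ₑ ≤ volume B * ∫⁻ z, ‖h z‖ₑ := by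
  have h1 : h y = ∫ ξ, Complex.exp (↑(-2 * Real.pi * inner ℝ ξ y) * Complex.I) •
      (𝓕⁻ h : 𝓢(E d, ℂ)) ξ := by
    have e : h = 𝓕 (𝓕⁻ h : 𝓢(E d, ℂ)) := (FourierTransform.fourier_fourierInv_eq h).symm
    conv_lhs => rw [e]
    rw [SchwartzMap.fourier_coe, Real.fourier_eq']
  have h2 : ∀ ξ, ‖(𝓕⁻ h : 𝓢(E d, ℂ)) ξ‖ₑ ≤ ∫⁻ z, ‖h z‖ₑ := by
    intro ξ
    rw [SchwartzMap.fourierInv_coe, Real.fourierInv_eq']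
    refine (enorm_integral_le_lintegral_enorm _).trans (le_of_eq (lintegral_congr fun z => ?_))
    rw [enorm_smul, ← ofReal_norm, Complex.norm_exp_ofReal_mul_I]
    simp
  rw [h1]
  calc _ ≤ ∫⁻ ξ, ‖(𝓕⁻ h : 𝓢(E d, ℂ)) ξ‖ₑ := by
        refine (enorm_integral_le_lintegral_enorm _).trans (le_of_eq (lintegral_congr fun z => ?_))
        rw [enorm_smul, ← ofReal_norm, Complex.norm_exp_ofReal_mul_I]
        simp
    _ = ∫⁻ ξ in B, ‖(𝓕⁻ h : 𝓢(E d, ℂ)) ξ‖ₑ := by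
        rw [setLIntegral_eq_of_support_subset]
        intro ξ hξ
        by_contra hn
        exact hξ (by simp [hs ξ hn])
    _ ≤ ∫⁻ ξ in B, ∫⁻ z, ‖h z‖ₑ := lintegral_mono fun ξ => h2 ξ
    _ = _ := by rw [setLIntegral_const, mul_comm]

/-- In `|h| = |h|^{1-p} |h|^p` the first factor is at most `(|B| ‖h‖₁)^{1-p}` by the Nikolskii
bound; after integration `‖h‖₁^{1-p}` is cancelled, being finite and nonzero. -/
lemma lintegral_enorm_rpow_le_of_bandlimited (h : 𝓢(E d, ℂ)) {B : Set (E d)}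
    (hs : ∀ ξ ∉ B, (𝓕⁻ h : 𝓢(E d, ℂ)) ξ = 0)
    {p : ℝ} (hp0 : 0 < p) (hp1 : p ≤ 1) :
    (∫⁻ z, ‖h z‖ₑ) ^ p ≤ volume B ^ (1 - p) * ∫⁻ z, ‖h z‖ₑ ^ p := by
  set A := ∫⁻ z, ‖h z‖ₑ with hA
  have hAt : A ≠ ∞ := by
    have := h.integrable (μ := volume)
    exact this.2.ne
  rcases eq_or_ne A 0 with h0 | h0
  · rw [h0, ENNReal.zero_rpow_of_pos hp0]; exact zero_le
  have key : A ≤ (volume B * A) ^ (1 - p) * ∫⁻ z, ‖h z‖ₑ ^ p := by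
    rw [← lintegral_const_mul _ (by fun_prop)]
    refine lintegral_mono fun z => ?_
    calc ‖h z‖ₑ = ‖h z‖ₑ ^ (1 - p) * ‖h z‖ₑ ^ p := by
          rw [← ENNReal.rpow_add_of_nonneg _ _ (by linarith) hp0.le]; simp
      _ ≤ _ := by
          gcongr
          exact enorm_le_measure_mul_lintegral h hs z
  rw [ENNReal.mul_rpow_of_nonneg _ _ (by linarith)] at key
  have hA1 : A ^ (1 - p) ≠ 0 := by
    simp [ENNReal.rpow_eq_zero_iff, h0, hAt]
  have hA2 : A ^ (1 - p) ≠ ∞ := ENNReal.rpow_ne_top_of_nonneg (by linarith) hAt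
  have e : A = A ^ p * A ^ (1 - p) := by
    rw [← ENNReal.rpow_add_of_nonneg _ _ hp0.le (by linarith)]; simp
  have key2 : A ^ p * A ^ (1 - p) ≤ (volume B ^ (1 - p) * ∫⁻ z, ‖h z‖ₑ ^ p) * A ^ (1 - p) := by
    rw [← e]; refine key.trans (le_of_eq (by ring))
  exact (ENNReal.mul_le_mul_iff_left hA1 hA2).1 key2

/-- The function `y ↦ g (x - y)` as a Schwartz function. -/
def reflectAt (x : E d) (g : 𝓢(E d, ℂ)) : 𝓢(E d, ℂ) :=
  SchwartzMap.compCLMOfAntilipschitz ℂ (K := 1) (g := fun y => x - y) (by fun_prop)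
    (fun a b => by rw [edist_dist, edist_dist, dist_sub_left x a b]; simp) g

lemma reflectAt_apply (x : E d) (g : 𝓢(E d, ℂ)) (y : E d) : reflectAt x g y = g (x - y) := rfl

lemma fourierInv_reflectAt (x : E d) (g : 𝓢(E d, ℂ)) (η : E d) :
    (𝓕⁻ (reflectAt x g) : 𝓢(E d, ℂ)) η =
      Complex.exp (↑(2 * Real.pi * inner ℝ x η) * Complex.I) * (𝓕 g : 𝓢(E d, ℂ)) η := by
  rw [SchwartzMap.fourierInv_coe, SchwartzMap.fourier_coe, Real.fourierInv_eq', Real.fourier_eq',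
    ← integral_const_mul,
    ← integral_sub_left_eq_self (fun y => Complex.exp (↑(2 * Real.pi * inner ℝ y η) * Complex.I) •
      reflectAt x g y) volume x]
  refine integral_congr_ae (Eventually.of_forall fun z => ?_)
  simp only [reflectAt_apply, sub_sub_cancel, smul_eq_mul, ← mul_assoc, ← Complex.exp_add,
    inner_sub_left]
  congr 2
  push_cast
  ring

/-- The inverse transform of the product `F · g(x - ·)` is a convolution of a function living on
`-Q₁` with one living on `Q₂`. The translation by `x` only modulates, so the band `B` does not
depend on `x`. -/
lemma fourierInv_mul_reflectAt_eq_zero {F g : 𝓢(E d, ℂ)} {Q₁ Q₂ B : Set (E d)}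
    (hF : ∀ ξ ∉ Q₁, (𝓕 F : 𝓢(E d, ℂ)) ξ = 0) (hg : ∀ ξ ∉ Q₂, (𝓕 g : 𝓢(E d, ℂ)) ξ = 0)
    (hB : ∀ ξ ∈ Q₁, ∀ η ∈ Q₂, η - ξ ∈ B) (x : E d) :
    ∀ ζ ∉ B, (𝓕⁻ (SchwartzMap.pairing (ContinuousLinearMap.mul ℂ ℂ) F (reflectAt x g)) :
      𝓢(E d, ℂ)) ζ = 0 := by
  intro ζ hζ
  have h1 : SchwartzMap.pairing (ContinuousLinearMap.mul ℂ ℂ) F (reflectAt x g) =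
      𝓕 (SchwartzMap.convolution (ContinuousLinearMap.mul ℂ ℂ) (𝓕⁻ F : 𝓢(E d, ℂ))
        (𝓕⁻ (reflectAt x g) : 𝓢(E d, ℂ))) := by
    rw [SchwartzMap.fourier_convolution, FourierTransform.fourier_fourierInv_eq,
      FourierTransform.fourier_fourierInv_eq]
  rw [h1, FourierTransform.fourierInv_fourier_eq, SchwartzMap.convolution_apply, convolution]
  refine integral_eq_zero_of_ae (Eventually.of_forall fun t => ?_)
  simp only [ContinuousLinearMap.mul_apply', Pi.zero_apply]
  have h2 : (𝓕⁻ F : 𝓢(E d, ℂ)) t = (𝓕 F : 𝓢(E d, ℂ)) (-t) := by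
    rw [SchwartzMap.fourierInv_apply_eq]; rfl
  rw [h2, fourierInv_reflectAt]
  by_cases ht : -t ∈ Q₁
  · by_cases ht2 : ζ - t ∈ Q₂
    · exact absurd (by simpa using hB _ ht _ ht2) hζ
    · rw [hg _ ht2]; simp
  · rw [hF _ ht]; simp

/-- For fixed `x` the integrand `y ↦ F y * g (x - y)` is band-limited to `B`, so its `L¹` norm is
controlled by its `L^p` norm; integrating in `x` leaves the `L¹` convolution of `|F|^p` and `|g|^p`.
-/
lemma eLpNorm_convolution_le_of_lt_one {F g : 𝓢(E d, ℂ)} {Q₁ Q₂ B : Set (E d)}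
    (hF : ∀ ξ ∉ Q₁, (𝓕 F : 𝓢(E d, ℂ)) ξ = 0) (hg : ∀ ξ ∉ Q₂, (𝓕 g : 𝓢(E d, ℂ)) ξ = 0)
    (hB : ∀ ξ ∈ Q₁, ∀ η ∈ Q₂, η - ξ ∈ B)
    {p : ℝ≥0∞} (hp0 : p ≠ 0) (hp1 : p < 1) :
    eLpNorm (fun x => ∫ y, F y * g (x - y)) p volume ≤
      volume B ^ (1 / p.toReal - 1) * eLpNorm F p volume * eLpNorm g p volume := by
  have hpt : p ≠ ∞ := (hp1.trans ENNReal.one_lt_top).ne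
  have hr0 : 0 < p.toReal := ENNReal.toReal_pos hp0 hpt
  have hr1 : p.toReal ≤ 1 := by
    simpa using (ENNReal.toReal_le_toReal hpt ENNReal.one_ne_top).2 hp1.le
  set r := p.toReal with hr
  rw [eLpNorm_eq_lintegral_rpow_enorm_toReal hp0 hpt,
    eLpNorm_eq_lintegral_rpow_enorm_toReal hp0 hpt,
    eLpNorm_eq_lintegral_rpow_enorm_toReal hp0 hpt, ← hr]
  have pt : ∀ x, ‖∫ y, F y * g (x - y)‖ₑ ^ r ≤
      volume B ^ (1 - r) * ∫⁻ y, ‖F y‖ₑ ^ r * ‖g (x - y)‖ₑ ^ r := by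
    intro x
    have := lintegral_enorm_rpow_le_of_bandlimited _
      (fourierInv_mul_reflectAt_eq_zero hF hg hB x) hr0 hr1
    simp only [SchwartzMap.pairing_apply_apply, ContinuousLinearMap.mul_apply', reflectAt_apply,
      enorm_mul, ENNReal.mul_rpow_of_nonneg _ _ hr0.le] at this
    refine le_trans ?_ this
    gcongr
    exact enorm_convolution_le F g x
  have hFm : Measurable fun y => ‖F y‖ₑ ^ r := F.continuous.enorm.measurable.pow_const r
  have hgm : Measurable fun y => ‖g y‖ₑ ^ r := g.continuous.enorm.measurable.pow_const r
  have main : ∫⁻ x, ‖∫ y, F y * g (x - y)‖ₑ ^ r ≤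
      volume B ^ (1 - r) * ((∫⁻ y, ‖F y‖ₑ ^ r) * ∫⁻ y, ‖g y‖ₑ ^ r) := by
    calc _ ≤ ∫⁻ x, volume B ^ (1 - r) * ∫⁻ y, ‖F y‖ₑ ^ r * ‖g (x - y)‖ₑ ^ r :=
          lintegral_mono pt
      _ = volume B ^ (1 - r) * ∫⁻ x, (∫⁻ y, ‖F y‖ₑ ^ r * ‖g (x - y)‖ₑ ^ r) ^ (1 : ℝ) := by
          simp only [ENNReal.rpow_one]
          rw [lintegral_const_mul]
          exact Measurable.lintegral_prod_right'
            (f := fun z : E d × E d => ‖F z.2‖ₑ ^ r * ‖g (z.1 - z.2)‖ₑ ^ r)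
            ((hFm.comp measurable_snd).mul (hgm.comp (measurable_fst.sub measurable_snd)))
      _ ≤ _ := by
          gcongr
          simpa using lintegral_rpow_lconvolution_le hFm hgm le_rfl
  calc _ ≤ (volume B ^ (1 - r) * ((∫⁻ y, ‖F y‖ₑ ^ r) * ∫⁻ y, ‖g y‖ₑ ^ r)) ^ (1 / r) := by
        gcongr
    _ = _ := by
        rw [ENNReal.mul_rpow_of_nonneg _ _ (by positivity),
          ENNReal.mul_rpow_of_nonneg _ _ (by positivity), ← ENNReal.rpow_mul, mul_assoc]
        congr 2
        field_simp

end Convolution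

/-! ### Upper bound for the decomposition space norm of synthesised functions. -/

section UpperBound

variable {d : ℕ} {I : Type*} {O : TopologicalSpace.Opens (E d)}

/-- A test function as a Schwartz function. -/
def testToSchwartz (φ : 𝓓(O, ℂ)) : 𝓢(E d, ℂ) :=
  φ.hasCompactSupport.toSchwartzMap φ.contDiff

lemma testToSchwartz_apply (φ : 𝓓(O, ℂ)) (ξ : E d) : testToSchwartz φ ξ = φ ξ := rfl

lemma fourierInv_testToSchwartz (φ : 𝓓(O, ℂ)) :
    ((𝓕⁻ (testToSchwartz φ) : 𝓢(E d, ℂ)) : E d → ℂ) = 𝓕⁻ (φ : E d → ℂ) := by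
  rw [SchwartzMap.fourierInv_coe]; rfl

lemma localPiece_fourierDistr_eq (φ : 𝓓(O, ℂ)) (f : 𝓢(E d, ℂ)) :
    localPiece φ (fourierDistr O f) = (𝓕⁻ (SchwartzMap.pairing (ContinuousLinearMap.mul ℂ ℂ)
      (testToSchwartz φ) (𝓕 f : 𝓢(E d, ℂ))) : 𝓢(E d, ℂ)) := by
  funext x
  have hloc : LocallyIntegrableOn ((𝓕 f : 𝓢(E d, ℂ)) : E d → ℂ) (O : Set (E d)) volume :=
    ((𝓕 f : 𝓢(E d, ℂ)).continuous.locallyIntegrable).locallyIntegrableOn _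
  rw [localPiece, fourierDistr, TestFunction.integralAgainstBilinCLM_eq_integral hloc,
    SchwartzMap.fourierInv_coe, Real.fourierInv_eq']
  refine integral_congr_ae (Eventually.of_forall fun ξ => ?_)
  have : modulate φ x ξ = φ ξ * Complex.exp (2 * Real.pi * Complex.I * (inner ℝ x ξ : ℝ)) := rfl
  simp only [this, ContinuousLinearMap.mul_apply', SchwartzMap.pairing_apply_apply,
    testToSchwartz_apply, smul_eq_mul, real_inner_comm ξ x]
  push_cast
  ring_nf

lemma localPiece_fourierDistr_eq_convolution (φ : 𝓓(O, ℂ)) (f : 𝓢(E d, ℂ)) :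
    localPiece φ (fourierDistr O f) = SchwartzMap.convolution (ContinuousLinearMap.mul ℂ ℂ)
      (𝓕⁻ (testToSchwartz φ) : 𝓢(E d, ℂ)) f := by
  rw [localPiece_fourierDistr_eq]
  have e : SchwartzMap.convolution (ContinuousLinearMap.mul ℂ ℂ)
      (𝓕⁻ (testToSchwartz φ) : 𝓢(E d, ℂ)) f = 𝓕⁻ (𝓕 (SchwartzMap.convolution
        (ContinuousLinearMap.mul ℂ ℂ) (𝓕⁻ (testToSchwartz φ) : 𝓢(E d, ℂ)) f)) :=
    (FourierTransform.fourierInv_fourier_eq _).symm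
  rw [e, SchwartzMap.fourier_convolution, FourierTransform.fourier_fourierInv_eq]

lemma localPiece_fourierDistr_eq_integral (φ : 𝓓(O, ℂ)) (f : 𝓢(E d, ℂ)) :
    localPiece φ (fourierDistr O f) =
      fun x => ∫ y, (𝓕⁻ (testToSchwartz φ) : 𝓢(E d, ℂ)) y * f (x - y) := by
  rw [localPiece_fourierDistr_eq_convolution]
  funext x
  rw [SchwartzMap.convolution_apply]
  rfl

lemma localPiece_fourierDistr_sum (φ : 𝓓(O, ℂ)) (S : Finset I) (a : I → ℂ) (g : I → 𝓢(E d, ℂ)) :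
    localPiece φ (fourierDistr O (∑ l ∈ S, a l • g l)) =
      ∑ l ∈ S, a l • localPiece φ (fourierDistr O (g l)) := by
  simp only [localPiece_fourierDistr_eq_convolution, map_sum, map_smul]
  ext x
  simp

lemma localPiece_fourierDistr_eq_zero {φ : 𝓓(O, ℂ)} {f : 𝓢(E d, ℂ)}
    (h : ∀ ξ, φ ξ * (𝓕 f : 𝓢(E d, ℂ)) ξ = 0) : localPiece φ (fourierDistr O f) = 0 := by
  have : SchwartzMap.pairing (ContinuousLinearMap.mul ℂ ℂ)
      (testToSchwartz φ) (𝓕 f : 𝓢(E d, ℂ)) = 0 := by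
    ext ξ
    simpa [testToSchwartz_apply] using h ξ
  rw [localPiece_fourierDistr_eq, this, FourierTransform.fourierInv_zero]
  rfl

namespace AffineFamily

variable {𝒬 : AffineFamily d I}

lemma IsSemiStructured.exists_norm_le {U : Set (E d)} (h : 𝒬.IsSemiStructured U) :
    ∃ R : ℝ, 0 ≤ R ∧ ∀ i, ∀ x ∈ 𝒬.Q' i, ‖x‖ ≤ R := by
  obtain ⟨R, hR⟩ := h.bounded.exists_norm_le
  exact ⟨max R 0, le_max_right _ _, fun i x hx =>
    (hR x (mem_iUnion.2 ⟨i, hx⟩)).trans (le_max_left _ _)⟩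

/-- A common point of `Q_i` and `Q_l` eliminates the shifts: `η - ξ = T_l (y₂ - y₁) + T_i (x₁ - x₂)`
with all four points in the normalized sets, and `T_i⁻¹ T_l` is bounded for neighbours. -/
lemma IsSemiStructured.exists_sub_mem {U : Set (E d)} (h : 𝒬.IsSemiStructured U) :
    ∃ R : ℝ, ∀ i, ∀ l ∈ 𝒬.nbr i, ∀ ξ ∈ 𝒬.Q i, ∀ η ∈ 𝒬.Q l,
      η - ξ ∈ 𝒬.T i '' Metric.closedBall 0 R := by
  obtain ⟨R, hR0, hR⟩ := h.exists_norm_le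
  obtain ⟨C, hC⟩ := h.compatible
  refine ⟨C * (2 * R) + 2 * R, ?_⟩
  rintro i l hl _ ⟨x₂, hx₂, rfl⟩ _ ⟨y₂, hy₂, rfl⟩
  obtain ⟨ζ, ⟨x₁, hx₁, hx⟩, ⟨y₁, hy₁, hy⟩⟩ := id hl
  refine ⟨(𝒬.T i).symm (𝒬.T l (y₂ - y₁)) + (x₁ - x₂), ?_, ?_⟩
  · rw [mem_closedBall_zero_iff]
    refine (norm_add_le _ _).trans (add_le_add ?_ ?_)
    · refine (((𝒬.T i).symm : E d →L[ℝ] E d) ∘L (𝒬.T l : E d →L[ℝ] E d)).le_of_opNorm_le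
        (hC i l hl) (y₂ - y₁) |>.trans ?_
      have hC0 : 0 ≤ C := (norm_nonneg _).trans (hC i l hl)
      gcongr
      linarith [norm_sub_le y₂ y₁, hR _ _ hy₂, hR _ _ hy₁]
    · linarith [norm_sub_le x₁ x₂, hR _ _ hx₂, hR _ _ hx₁]
  · have : 𝒬.T i x₁ + 𝒬.b i = 𝒬.T l y₁ + 𝒬.b l := hx.trans hy.symm
    simp only [map_add, map_sub, ContinuousLinearEquiv.apply_symm_apply]
    rw [eq_sub_of_add_eq this]
    abel

/-- For `p ≥ 1` this is Young's inequality. For `p < 1` the differences `Q_l - Q_i` lie in `T_i` of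
a fixed ball, whose volume produces exactly the factor `|det T_i|^{1/p-1}` that the BAPU condition
absorbs. -/
lemma IsBAPU.exists_eLpNorm_localPiece_le {p : ℝ≥0∞} (hp : 0 < p) {φ : I → 𝓓(O, ℂ)}
    (hφ : 𝒬.IsBAPU p φ) (h : 𝒬.IsSemiStructured (O : Set (E d))) :
    ∃ C : ℝ≥0, ∀ i, ∀ l ∈ 𝒬.nbr i, ∀ g : 𝓢(E d, ℂ), (∀ ξ ∉ 𝒬.Q l, (𝓕 g : 𝓢(E d, ℂ)) ξ = 0) →
      eLpNorm (localPiece (φ i) (fourierDistr O g)) p volume ≤ C * eLpNorm g p volume := by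
  rcases le_or_gt 1 p with h1 | h1
  · obtain ⟨C, hC⟩ := hφ.bound_of_one_le h1
    refine ⟨C, fun i l _ g _ => ?_⟩
    rw [localPiece_fourierDistr_eq_integral]
    refine (eLpNorm_convolution_le_of_one_le (SchwartzMap.continuous _) g.continuous h1).trans ?_
    gcongr
    rw [fourierInv_testToSchwartz]
    exact hC i
  · obtain ⟨C, hC⟩ := hφ.bound_of_lt_one h1
    obtain ⟨R, hR⟩ := h.exists_sub_mem
    have hpt : p ≠ ∞ := (h1.trans ENNReal.one_lt_top).ne
    have hr0 : 0 < p.toReal := ENNReal.toReal_pos hp.ne' hpt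
    have hr1 : p.toReal ≤ 1 := by
      simpa using (ENNReal.toReal_le_toReal hpt ENNReal.one_ne_top).2 h1.le
    have he : 0 ≤ 1 / p.toReal - 1 := by
      rw [sub_nonneg, le_div_iff₀ hr0]; linarith
    set V := volume (Metric.closedBall (0 : E d) R) with hV
    have hVt : V ≠ ∞ := measure_closedBall_lt_top.ne
    refine ⟨(V ^ (1 / p.toReal - 1)).toNNReal * C, fun i l hl g hg => ?_⟩
    rw [localPiece_fourierDistr_eq_integral]
    refine (eLpNorm_convolution_le_of_lt_one (Q₁ := 𝒬.Q i) (fun ξ hξ => ?_) hg (hR i l hl)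
      hp.ne' h1).trans ?_
    · rw [FourierTransform.fourier_fourierInv_eq]
      exact hφ.partition.eq_zero i ξ hξ
    · have hvol : volume (𝒬.T i '' Metric.closedBall 0 R) = ENNReal.ofReal (𝒬.absDet i) * V :=
        Measure.addHaar_image_continuousLinearEquiv volume (𝒬.T i) _
      rw [hvol, ENNReal.mul_rpow_of_nonneg _ _ he, fourierInv_testToSchwartz,
        ENNReal.ofReal_rpow_of_nonneg (show 0 ≤ 𝒬.absDet i from abs_nonneg _) he]
      push_cast
      rw [ENNReal.coe_toNNReal (ENNReal.rpow_ne_top_of_nonneg he hVt)]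
      gcongr ?_ * _
      calc _ = V ^ (1 / p.toReal - 1) * (ENNReal.ofReal (𝒬.absDet i ^ (1 / p.toReal - 1)) *
            eLpNorm (𝓕⁻ (φ i : E d → ℂ)) p volume) := by ring
        _ ≤ _ := by gcongr; exact hC i

end AffineFamily

/-- Iterated quasi-triangle inequality. The crude exponent is harmless because it is applied to at
most `sup_i |i^*|` terms; the maximum with `1` makes the power monotone in the number of terms. -/
lemma eLpNorm_sum_le_pow_mul {p : ℝ≥0∞} (S : Finset I) (f : I → E d → ℂ)
    (hf : ∀ l ∈ S, AEStronglyMeasurable (f l) volume) :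
    eLpNorm (∑ l ∈ S, f l) p volume ≤
      (max 1 (ENNReal.LpAddConst p)) ^ S.card * ∑ l ∈ S, eLpNorm (f l) p volume := by
  classical
  induction S using Finset.induction_on with
  | empty => simp
  | insert m S hm ih =>
    rw [Finset.sum_insert hm, Finset.sum_insert hm, Finset.card_insert_of_notMem hm]
    have hfm := hf m (Finset.mem_insert_self _ _)
    have hfS : ∀ l ∈ S, AEStronglyMeasurable (f l) volume :=
      fun l hl => hf l (Finset.mem_insert_of_mem hl)
    set A := max 1 (ENNReal.LpAddConst p) with hA
    have h1 : 1 ≤ A ^ S.card := one_le_pow₀ (le_max_left _ _)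
    calc _ ≤ ENNReal.LpAddConst p * (eLpNorm (f m) p volume + eLpNorm (∑ l ∈ S, f l) p volume) :=
          eLpNorm_add_le' hfm (Finset.aestronglyMeasurable_sum S hfS) p
      _ ≤ A * (A ^ S.card * eLpNorm (f m) p volume +
            A ^ S.card * ∑ l ∈ S, eLpNorm (f l) p volume) := by
          gcongr
          · exact le_max_right _ _
          · exact le_mul_of_one_le_left zero_le h1
          · exact ih hfS
      _ = _ := by ring

/-- Synthesis bound: a finite combination of functions, the `l`-th of which has Fourier transform
supported in `Q_l`, has decomposition space norm bounded by the norm of the coefficients. -/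
theorem exists_decompNorm_sum_le {p : ℝ≥0∞} (hp : 0 < p) {𝒬 : AffineFamily d I}
    (h : 𝒬.IsSemiStructured (O : Set (E d))) {φ : I → 𝓓(O, ℂ)} (hφ : 𝒬.IsBAPU p φ)
    {Y : SequenceSpace I} (hY : Y.IsRegular 𝒬) (K : ℝ≥0) :
    ∃ C : ℝ≥0, ∀ (g : I → 𝓢(E d, ℂ)) (S : Finset I) (c : Y.carrier) (a : I → ℂ),
      (∀ l ∈ S, ∀ ξ ∉ 𝒬.Q l, (𝓕 (g l) : 𝓢(E d, ℂ)) ξ = 0) →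
      (∀ l ∈ S, eLpNorm (g l) p volume ≤ K) → (∀ l ∈ S, ‖a l‖ ≤ ‖(c : I → ℂ) l‖) →
      decompNorm φ p Y (∑ l ∈ S, a l • g l) ≤ C * ENNReal.ofReal (Y.qnorm c) := by
  classical
  obtain ⟨C₁, hC₁⟩ := hφ.exists_eLpNorm_localPiece_le hp h
  obtain ⟨N, hN⟩ := h.admissible.2
  obtain ⟨C₂, hC₂⟩ := hY
  set A : ℝ≥0 := (max 1 (ENNReal.LpAddConst p)).toNNReal with hA
  have hAc : (A : ℝ≥0∞) = max 1 (ENNReal.LpAddConst p) :=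
    ENNReal.coe_toNNReal (max_lt ENNReal.one_lt_top (ENNReal.LpAddConst_lt_top p)).ne
  have hA1 : 1 ≤ A := by
    rw [← ENNReal.coe_le_coe, hAc]; exact_mod_cast le_max_left _ _
  set D : ℝ≥0 := A ^ N * (C₁ * K) with hD
  refine ⟨D * C₂.toNNReal, fun g S c a hg hK ha => ?_⟩
  have hfin : ∀ i, (𝒬.nbr i).Finite := fun i => Set.finite_of_encard_le_coe (hN i)
  have hcard : ∀ i, (hfin i).toFinset.card ≤ N := fun i => by
    have := hN i
    rw [(hfin i).encard_eq_coe_toFinset_card] at this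
    exact_mod_cast this
  -- the coefficientwise bound
  set e : I → ℝ≥0∞ :=
    fun i => eLpNorm (localPiece (φ i) (fourierDistr O (∑ l ∈ S, a l • g l))) p volume with he
  have hle : ∀ i, e i ≤ ((D * ∑ l ∈ (hfin i).toFinset, ‖(c : I → ℂ) l‖₊ : ℝ≥0) : ℝ≥0∞) := by
    intro i
    have hcont : ∀ l, AEStronglyMeasurable (a l • localPiece (φ i) (fourierDistr O (g l)))
        (volume : Measure (E d)) := fun l => by
      rw [localPiece_fourierDistr_eq_convolution]
      exact (SchwartzMap.continuous _).aestronglyMeasurable.const_smul _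
    -- If `l` is not a neighbour of `i`, then `φ_i` and the transform of `g l` live on disjoint
    -- sets.
    have hsum : ∑ l ∈ S, a l • localPiece (φ i) (fourierDistr O (g l)) =
        ∑ l ∈ S.filter (· ∈ 𝒬.nbr i), a l • localPiece (φ i) (fourierDistr O (g l)) := by
      rw [Finset.sum_filter]
      refine Finset.sum_congr rfl fun l hl => ?_
      split_ifs with hln
      · rfl
      · rw [localPiece_fourierDistr_eq_zero, smul_zero]
        intro ξ
        by_cases h1 : ξ ∈ 𝒬.Q i
        · rw [hg l hl ξ fun h2 => hln ⟨ξ, h1, h2⟩, mul_zero]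
        · rw [hφ.partition.eq_zero i ξ h1, zero_mul]
    have hsub : S.filter (· ∈ 𝒬.nbr i) ⊆ (hfin i).toFinset := fun l hl => by
      simpa using (Finset.mem_filter.1 hl).2
    simp only [he]
    rw [localPiece_fourierDistr_sum, hsum]
    refine (eLpNorm_sum_le_pow_mul _ _ fun l _ => hcont l).trans ?_
    rw [← hAc]
    calc _ ≤ (A : ℝ≥0∞) ^ N * ∑ l ∈ S.filter (· ∈ 𝒬.nbr i), ‖(c : I → ℂ) l‖ₑ * (C₁ * K) := by
          gcongr with l hl
          · exact_mod_cast hA1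
          · exact (Finset.card_le_card hsub).trans (hcard i)
          · obtain ⟨hlS, hln⟩ := Finset.mem_filter.1 hl
            rw [eLpNorm_const_smul]
            gcongr
            · exact enorm_le_iff_norm_le.2 (ha l hlS)
            · exact (hC₁ i l hln (g l) (hg l hlS)).trans (by gcongr; exact hK l hlS)
      _ ≤ (A : ℝ≥0∞) ^ N * ∑ l ∈ (hfin i).toFinset, ‖(c : I → ℂ) l‖ₑ * (C₁ * K) := by
          gcongr
      _ = _ := by
          rw [← Finset.sum_mul, hD]
          simp only [enorm_eq_nnnorm]
          push_cast
          ring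
  -- the clustered sequence of absolute values
  obtain ⟨hx, hxc⟩ := Y.solid (fun l => (‖(c : I → ℂ) l‖ : ℂ)) c fun l => by simp
  obtain ⟨hz, hzc⟩ := hC₂ ⟨_, hx⟩
  obtain ⟨hw, hwc⟩ := Y.solid (fun i => ((e i).toReal : ℂ)) ((D : ℂ) • ⟨_, hz⟩) fun i => by
    have h1 : (e i).toReal ≤ D * ∑ l ∈ (hfin i).toFinset, ‖(c : I → ℂ) l‖ := by
      have := ENNReal.toReal_mono ENNReal.coe_ne_top (hle i)
      rw [ENNReal.coe_toReal] at this
      push_cast at this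
      exact this
    have h2 : ∑ᶠ l ∈ 𝒬.nbr i, (‖(c : I → ℂ) l‖ : ℂ) =
        ((∑ l ∈ (hfin i).toFinset, ‖(c : I → ℂ) l‖ : ℝ) : ℂ) := by
      rw [finsum_mem_eq_finite_toFinset_sum _ (hfin i)]
      push_cast
      rfl
    have h3 : 0 ≤ ∑ l ∈ (hfin i).toFinset, ‖(c : I → ℂ) l‖ :=
      Finset.sum_nonneg fun _ _ => norm_nonneg _
    simp only [Submodule.coe_smul, Pi.smul_apply, smul_eq_mul, h2, norm_mul, Complex.norm_real,
      Real.norm_eq_abs, abs_of_nonneg h3, ENNReal.abs_toReal]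
    simpa using h1
  have hcond : (∀ i, e i ≠ ∞) ∧ (fun i => ((e i).toReal : ℂ)) ∈ Y.carrier :=
    ⟨fun i => ((hle i).trans_lt ENNReal.coe_lt_top).ne, hw⟩
  have hdn : decompNorm φ p Y (∑ l ∈ S, a l • g l) =
      ENNReal.ofReal (Y.qnorm ⟨_, hw⟩) := by
    rw [decompNorm, fourierSideNorm, SequenceSpace.extNorm, dif_pos hcond]
  rw [hdn]
  have hfinal : Y.qnorm ⟨_, hw⟩ ≤ (D * C₂.toNNReal : ℝ≥0) * Y.qnorm c := by
    rw [Y.qnorm_smul] at hwc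
    have h0 := Y.qnorm_nonneg ⟨_, hx⟩
    calc _ ≤ D * Y.qnorm ⟨_, hz⟩ := by simpa using hwc
      _ ≤ D * (C₂.toNNReal * Y.qnorm c) := by
          gcongr
          refine hzc.trans ?_
          -- The regularity constant `C₂` is not assumed nonnegative, hence the maximum with `0`.
          rw [Real.coe_toNNReal']
          exact (mul_le_mul_of_nonneg_right (le_max_left _ _) h0).trans
            (mul_le_mul_of_nonneg_left hxc (le_max_right _ _))
      _ = _ := by push_cast; ring
  calc _ ≤ ENNReal.ofReal ((D * C₂.toNNReal : ℝ≥0) * Y.qnorm c) := ENNReal.ofReal_le_ofReal hfinal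
    _ = _ := by
      rw [ENNReal.ofReal_mul (NNReal.coe_nonneg _), ENNReal.ofReal_coe_nnreal]

end UpperBound

/-! ### Placing a bump inside `Q_i` away from the zeros of one coordinate. -/

section Geometry

variable {d : ℕ} {I : Type*}

lemma norm_le_sum_abs (x : E d) : ‖x‖ ≤ ∑ j, |x j| := by
  have h : x = ∑ j, x j • EuclideanSpace.single j (1 : ℝ) := by
    ext i
    simp [Finset.sum_apply, Pi.single_apply]
  calc ‖x‖ = ‖∑ j, x j • EuclideanSpace.single j (1 : ℝ)‖ := by rw [← h]
    _ ≤ ∑ j, ‖x j • EuclideanSpace.single j (1 : ℝ)‖ := norm_sum_le _ _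
    _ = _ := by simp [norm_smul]

/-- The `j`-th row of a linear map, as a vector. -/
def row (A : E d →L[ℝ] E d) (j : Fin d) : E d :=
  ContinuousLinearMap.adjoint A (EuclideanSpace.single j 1)

lemma inner_row (A : E d →L[ℝ] E d) (j : Fin d) (η : E d) : inner ℝ (row A j) η = A η j := by
  rw [row, ContinuousLinearMap.adjoint_inner_left]
  simp [EuclideanSpace.inner_single_left]

lemma norm_le_sum_norm_row (A : E d →L[ℝ] E d) : ‖A‖ ≤ ∑ j, ‖row A j‖ := by
  refine A.opNorm_le_bound (Finset.sum_nonneg fun _ _ => norm_nonneg _) fun x => ?_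
  refine (norm_le_sum_abs _).trans ?_
  rw [Finset.sum_mul]
  refine Finset.sum_le_sum fun j _ => ?_
  rw [← inner_row]
  exact abs_real_inner_le_norm _ _

/-- Inside the image of a ball under an affine map there is the image of a smaller ball on which
some coordinate has constant sign and is comparable to the size of the affine map. -/
lemma exists_coord_lower_bound (hd : 1 ≤ d) {ε : ℝ} (hε : 0 < ε) (A : E d →L[ℝ] E d) (b c : E d) :
    ∃ (u : E d) (j : Fin d) (s : ℝ), (s = 1 ∨ s = -1) ∧ ∀ η : E d, ‖η‖ < ε / 4 →
      u + η ∈ Metric.ball c ε ∧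
      min 1 (ε / 4) / d * (‖A c + b‖ + ‖A‖) ≤ s * (A (u + η) + b) j := by
  have hd0 : (0 : ℝ) < d := by exact_mod_cast hd
  have : Nonempty (Fin d) := ⟨⟨0, hd⟩⟩
  set v := A c + b with hv
  set m := min 1 (ε / 4) with hm
  -- Pigeonhole over the `d` coordinates: one of them carries a `1/d` share of `‖v‖ + ‖A‖`.
  obtain ⟨j, -, hj⟩ := Finset.exists_le_of_sum_le (s := (Finset.univ : Finset (Fin d)))
    (f := fun _ => (‖v‖ + ‖A‖) / d) (g := fun j => |v j| + ‖row A j‖) Finset.univ_nonempty (by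
      simp only [Finset.sum_const, Finset.card_univ, Fintype.card_fin, nsmul_eq_mul,
        Finset.sum_add_distrib]
      rw [mul_div_cancel₀ _ hd0.ne']
      exact add_le_add (norm_le_sum_abs v) (norm_le_sum_norm_row A))
  obtain ⟨s, hs, hsv⟩ : ∃ s : ℝ, (s = 1 ∨ s = -1) ∧ s * v j = |v j| := by
    rcases le_total 0 (v j) with h | h
    · exact ⟨1, Or.inl rfl, by rw [abs_of_nonneg h, one_mul]⟩
    · exact ⟨-1, Or.inr rfl, by rw [abs_of_nonpos h]; ring⟩
  have hs1 : |s| = 1 := by rcases hs with rfl | rfl <;> simp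
  have hss : s * s = 1 := by rcases hs with rfl | rfl <;> norm_num
  set a := row A j with ha
  -- If `a = 0`, this is `w = 0` and the argument below still applies.
  set w : E d := ‖a‖⁻¹ • a with hw
  have hw1 : ‖w‖ ≤ 1 := by
    rw [hw, norm_smul, norm_inv, norm_norm]
    exact inv_mul_le_one_of_le₀ le_rfl (norm_nonneg _)
  have haw : inner ℝ a w = ‖a‖ := by
    rw [hw, inner_smul_right, real_inner_self_eq_norm_sq]
    rcases eq_or_ne ‖a‖ 0 with h | h
    · simp [h]
    · field_simp
  -- Moving by `ε/2` along the row, in the direction of the sign of `v j`, increases `|v j|` by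
  -- `(ε/2)‖a‖`; the perturbation `η` takes back at most `(ε/4)‖a‖`.
  refine ⟨c + (s * (ε / 2)) • w, j, s, hs, fun η hη => ⟨?_, ?_⟩⟩
  · rw [mem_ball_iff_norm]
    have : c + (s * (ε / 2)) • w + η - c = (s * (ε / 2)) • w + η := by abel
    rw [this]
    calc _ ≤ ‖(s * (ε / 2)) • w‖ + ‖η‖ := norm_add_le _ _
      _ ≤ ε / 2 * 1 + ‖η‖ := by
          rw [norm_smul, Real.norm_eq_abs, abs_mul, hs1, abs_of_pos (by positivity), one_mul]
          gcongr
      _ < ε := by linarith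
  · have e : (A (c + (s * (ε / 2)) • w + η) + b) j =
        v j + s * (ε / 2) * ‖a‖ + inner ℝ a η := by
      rw [inner_row, ← haw, inner_row, hv]
      simp only [map_add, map_smul, PiLp.add_apply, PiLp.smul_apply, smul_eq_mul]
      ring
    have hin : -(‖a‖ * (ε / 4)) ≤ s * inner ℝ a η := by
      have h1 : |s * inner ℝ a η| ≤ ‖a‖ * ‖η‖ := by
        rw [abs_mul, hs1, one_mul]; exact abs_real_inner_le_norm _ _
      have h2 : ‖a‖ * ‖η‖ ≤ ‖a‖ * (ε / 4) := by gcongr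
      linarith [neg_abs_le (s * inner ℝ a η)]
    have h3 : s * (v j + s * (ε / 2) * ‖a‖ + inner ℝ a η) =
        |v j| + ε / 2 * ‖a‖ + s * inner ℝ a η := by
      rw [← hsv]; linear_combination (ε / 2 * ‖a‖) * hss
    rw [e, h3]
    calc m / d * (‖v‖ + ‖A‖) = m * ((‖v‖ + ‖A‖) / d) := by ring
      _ ≤ m * (|v j| + ‖a‖) := by
          have : 0 < m := lt_min one_pos (by positivity)
          gcongr
      _ ≤ |v j| + ε / 4 * ‖a‖ := by
          rw [mul_add]
          gcongr
          · exact mul_le_of_le_one_left (abs_nonneg _) (min_le_left _ _)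
          · exact min_le_right _ _
      _ ≤ _ := by linarith

variable {𝒬 : AffineFamily d I}

/-- The centre `c` of the ball in `Q_i'` satisfies `‖c‖ ≤ R`, so `‖b‖ ≤ ‖T c + b‖ + R‖T‖`; this
trades `‖T c + b‖ + ‖T‖` for `‖b‖ + ‖T‖` at the cost of `1 + R`. -/
lemma exists_center (hd : 1 ≤ d) {U : Set (E d)} (h : 𝒬.IsSemiStructured U) (ht : 𝒬.IsTight) :
    ∃ ρ > 0, ∃ κ > 0, ∀ i, ∃ (ζ : E d) (j : Fin d) (s : ℝ), (s = 1 ∨ s = -1) ∧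
      ∀ η : E d, ‖η‖ < ρ → 𝒬.T i η + ζ ∈ 𝒬.Q i ∧
        κ * (‖𝒬.b i‖ + 𝒬.normT i) ≤ s * (𝒬.T i η + ζ) j := by
  obtain ⟨ε, hε, hc⟩ := ht
  obtain ⟨R, hR0, hR⟩ := h.exists_norm_le
  have hd0 : (0 : ℝ) < d := by exact_mod_cast hd
  have hm : 0 < min 1 (ε / 4) := lt_min one_pos (by positivity)
  refine ⟨ε / 4, by positivity, min 1 (ε / 4) / d / (1 + R), by positivity, fun i => ?_⟩
  obtain ⟨c, hci⟩ := hc i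
  obtain ⟨u, j, s, hs, H⟩ := exists_coord_lower_bound hd hε (𝒬.T i : E d →L[ℝ] E d) (𝒬.b i) c
  refine ⟨𝒬.T i u + 𝒬.b i, j, s, hs, fun η hη => ?_⟩
  obtain ⟨h1, h2⟩ := H η hη
  have e : 𝒬.T i η + (𝒬.T i u + 𝒬.b i) = 𝒬.T i (u + η) + 𝒬.b i := by
    rw [map_add]; abel
  rw [e]
  refine ⟨⟨_, hci h1, rfl⟩, le_trans ?_ h2⟩
  have hcR : ‖c‖ ≤ R := hR i c (hci (Metric.mem_ball_self hε))
  have hb : ‖𝒬.b i‖ ≤ ‖𝒬.T i c + 𝒬.b i‖ + 𝒬.normT i * R := by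
    have h3 : ‖𝒬.T i c‖ ≤ 𝒬.normT i * R :=
      ((𝒬.T i : E d →L[ℝ] E d).le_opNorm c).trans (by rw [AffineFamily.normT]; gcongr)
    have h4 := norm_sub_le (𝒬.T i c + 𝒬.b i) (𝒬.T i c)
    rw [add_sub_cancel_left] at h4
    linarith
  have hn : 0 ≤ 𝒬.normT i := norm_nonneg _
  have h5 : ‖𝒬.b i‖ + 𝒬.normT i ≤ (1 + R) * (‖𝒬.T i c + 𝒬.b i‖ + 𝒬.normT i) := by
    nlinarith [norm_nonneg (𝒬.T i c + 𝒬.b i)]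
  calc _ = min 1 (ε / 4) / d * ((‖𝒬.b i‖ + 𝒬.normT i) / (1 + R)) := by ring
    _ ≤ min 1 (ε / 4) / d * (‖𝒬.T i c + 𝒬.b i‖ + 𝒬.normT i) := by
        gcongr
        rw [div_le_iff₀ (by positivity)]
        linarith
    _ = _ := rfl

end Geometry

/-! ### Pure derivatives `∂_j^k` on the Fourier side. -/

section Derivatives

variable {d : ℕ}

lemma fourier_lineDeriv_iterate (j : Fin d) (n : ℕ) (f : 𝓢(E d, ℂ)) (ξ : E d) :
    (𝓕 ((∂_{(EuclideanSpace.single j (1 : ℝ) : E d)})^[n] f) : 𝓢(E d, ℂ)) ξ =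
      (2 * Real.pi * Complex.I * (ξ j : ℂ)) ^ n * (𝓕 f : 𝓢(E d, ℂ)) ξ := by
  induction n generalizing f with
  | zero => simp
  | succ n ih =>
    rw [Function.iterate_succ_apply, ih, SchwartzMap.fourier_lineDerivOp_eq]
    have ht : Function.HasTemperateGrowth
        fun x : E d => inner ℝ x (EuclideanSpace.single j (1 : ℝ) : E d) := by fun_prop
    rw [smul_apply, SchwartzMap.smulLeftCLM_apply_apply ht]
    simp only [EuclideanSpace.inner_single_right, smul_eq_mul, Complex.real_smul]
    simp
    ring

lemma fourier_multiDeriv_single (j : Fin d) (k : ℕ) (f : 𝓢(E d, ℂ)) (ξ : E d) :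
    (𝓕 (multiDeriv (Pi.single j k) f) : 𝓢(E d, ℂ)) ξ =
      (2 * Real.pi * Complex.I * (ξ j : ℂ)) ^ k * (𝓕 f : 𝓢(E d, ℂ)) ξ := by
  -- Stated for an arbitrary list so that the induction can run; only `L = List.finRange d` is used.
  have h : ∀ L : List (Fin d), (𝓕 (L.foldr (fun j' g =>
      (∂_{(EuclideanSpace.single j' (1 : ℝ) : E d)})^[(Pi.single j k : Fin d → ℕ) j'] g) f) :
        𝓢(E d, ℂ)) ξ =
      (L.map fun j' => (2 * Real.pi * Complex.I * (ξ j' : ℂ)) ^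
        ((Pi.single j k : Fin d → ℕ) j')).prod * (𝓕 f : 𝓢(E d, ℂ)) ξ := by
    intro L
    induction L with
    | nil => simp
    | cons a L ih =>
      rw [List.foldr_cons, fourier_lineDeriv_iterate, ih, List.map_cons, List.prod_cons]
      ring
  rw [multiDeriv, h, ← List.ofFn_eq_map, List.prod_ofFn, Finset.prod_eq_single j]
  · simp
  · intro b _ hb
    simp [Pi.single_eq_of_ne hb]
  · simp

lemma multiDeriv_single_eq_integral (j : Fin d) (k : ℕ) (f : 𝓢(E d, ℂ)) (y : E d) :
    multiDeriv (Pi.single j k) f y =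
      ∫ ξ, Complex.exp (↑(2 * Real.pi * inner ℝ ξ y) * Complex.I) *
        ((2 * Real.pi * Complex.I * (ξ j : ℂ)) ^ k * (𝓕 f : 𝓢(E d, ℂ)) ξ) := by
  have e : multiDeriv (Pi.single j k) f = 𝓕⁻ (𝓕 (multiDeriv (Pi.single j k) f)) :=
    (FourierTransform.fourierInv_fourier_eq _).symm
  conv_lhs => rw [e]
  rw [SchwartzMap.fourierInv_coe, Real.fourierInv_eq']
  simp only [fourier_multiDeriv_single, smul_eq_mul]

lemma multiDeriv_single_sum {ι : Type*} (j : Fin d) (k : ℕ) (S : Finset ι) (a : ι → ℂ)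
    (g : ι → 𝓢(E d, ℂ)) (y : E d) :
    multiDeriv (Pi.single j k) (∑ l ∈ S, a l • g l) y =
      ∑ l ∈ S, a l * multiDeriv (Pi.single j k) (g l) y := by
  have e : multiDeriv (Pi.single j k) (∑ l ∈ S, a l • g l) =
      ∑ l ∈ S, a l • multiDeriv (Pi.single j k) (g l) := by
    -- Linearity is verified on the Fourier side, where the derivative is multiplication by a
    -- polynomial.
    have hinj : Function.Injective (FourierTransform.fourierCLM ℂ 𝓢(E d, ℂ)) := fun u v huv => by
      have : (𝓕 u : 𝓢(E d, ℂ)) = 𝓕 v := huv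
      have hu : 𝓕⁻ (𝓕 u : 𝓢(E d, ℂ)) = u := FourierTransform.fourierInv_fourier_eq u
      have hv : 𝓕⁻ (𝓕 v : 𝓢(E d, ℂ)) = v := FourierTransform.fourierInv_fourier_eq v
      rw [← hu, this, hv]
    apply hinj
    ext ξ
    rw [map_sum]
    simp only [map_smul, sum_apply, smul_apply, FourierTransform.fourierCLM_apply,
      fourier_multiDeriv_single]
    rw [← FourierTransform.fourierCLM_apply (R := ℂ), map_sum]
    simp only [map_smul, sum_apply, smul_apply, FourierTransform.fourierCLM_apply,
      Finset.mul_sum, smul_eq_mul]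
    exact Finset.sum_congr rfl fun _ _ => by ring
  rw [e]
  simp

end Derivatives

/-! ### Atoms: norms and lower bounds for their derivatives. -/

section Atoms

variable {d : ℕ}

/-- `|det A|`. -/
def detAbs (A : E d ≃L[ℝ] E d) : ℝ := |LinearMap.det (A.toLinearEquiv : E d →ₗ[ℝ] E d)|

lemma detAbs_pos (A : E d ≃L[ℝ] E d) : 0 < detAbs A :=
  abs_pos.2 (LinearEquiv.isUnit_det' A.toLinearEquiv).ne_zero

lemma det_adjoint (A : E d →ₗ[ℝ] E d) :
    LinearMap.det (LinearMap.adjoint A) = LinearMap.det A := by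
  let v := EuclideanSpace.basisFun (Fin d) ℝ
  rw [← LinearMap.det_toMatrix v.toBasis, LinearMap.toMatrix_adjoint,
    Matrix.det_conjTranspose, LinearMap.det_toMatrix]
  simp

/-- The adjoint of an invertible linear map. -/
abbrev adj (A : E d ≃L[ℝ] E d) : E d →L[ℝ] E d :=
  ContinuousLinearMap.adjoint (A : E d →L[ℝ] E d)

lemma abs_det_adj (A : E d ≃L[ℝ] E d) :
    |LinearMap.det (adj A : E d →ₗ[ℝ] E d)| = detAbs A := by
  rw [detAbs, ← det_adjoint (A.toLinearEquiv : E d →ₗ[ℝ] E d)]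
  rfl

lemma det_adj_ne_zero (A : E d ≃L[ℝ] E d) : LinearMap.det (adj A : E d →ₗ[ℝ] E d) ≠ 0 := by
  rw [← abs_pos, abs_det_adj]; exact detAbs_pos A

lemma integral_comp_equiv (A : E d ≃L[ℝ] E d) (f : E d → ℂ) :
    ∫ ξ, f ξ = (detAbs A : ℂ) * ∫ η, f (A η) := by
  have h1 : Measure.map A (volume : Measure (E d)) = ENNReal.ofReal (detAbs A)⁻¹ • volume := by
    have := Measure.map_linearMap_addHaar_eq_smul_addHaar (volume : Measure (E d))
      (f := (A.toLinearEquiv : E d →ₗ[ℝ] E d)) (LinearEquiv.isUnit_det' A.toLinearEquiv).ne_zero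
    rw [abs_inv] at this
    exact this
  have h2 : ∫ η, f (A η) = ∫ ξ, f ξ ∂(Measure.map A volume) :=
    (A.toHomeomorph.measurableEmbedding.integral_map f).symm
  rw [h2, h1, integral_smul_measure, ENNReal.toReal_ofReal (by have := detAbs_pos A; positivity),
    Complex.real_smul, ← mul_assoc]
  have := (detAbs_pos A).ne'
  push_cast
  rw [mul_inv_cancel₀ (by exact_mod_cast this), one_mul]

/-- The Fourier transform of an atom: a bump function, transported by the affine map
`η ↦ A η + ζ`, times the character corresponding to a translation by `x`. -/
def atomHat (ψ : ContDiffBump (0 : E d)) (A : E d ≃L[ℝ] E d) (ζ x ξ : E d) : ℂ :=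
  (ψ (A.symm (ξ - ζ)) : ℂ) * Complex.exp (↑(-2 * Real.pi * inner ℝ ξ x) * Complex.I)

lemma atomHat_eq_zero (ψ : ContDiffBump (0 : E d)) (A : E d ≃L[ℝ] E d) (ζ x : E d) {ξ : E d}
    (h : ξ ∉ (fun η => A η + ζ) '' Metric.closedBall 0 ψ.rOut) : atomHat ψ A ζ x ξ = 0 := by
  have : ψ (A.symm (ξ - ζ)) = 0 := by
    refine ψ.zero_of_le_dist ?_
    by_contra hlt
    exact h ⟨A.symm (ξ - ζ), by simpa using (not_le.1 hlt).le, by simp⟩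
  rw [atomHat, this]; simp

lemma isCompact_image_closedBall (A : E d ≃L[ℝ] E d) (ζ : E d) (r : ℝ) :
    IsCompact ((fun η => A η + ζ) '' Metric.closedBall 0 r) :=
  (isCompact_closedBall _ _).image (by fun_prop)

lemma hasCompactSupport_atomHat (ψ : ContDiffBump (0 : E d)) (A : E d ≃L[ℝ] E d) (ζ x : E d) :
    HasCompactSupport (atomHat ψ A ζ x) :=
  HasCompactSupport.intro (isCompact_image_closedBall A ζ ψ.rOut)
    fun _ h => atomHat_eq_zero ψ A ζ x h

lemma contDiff_atomHat (ψ : ContDiffBump (0 : E d)) (A : E d ≃L[ℝ] E d) (ζ x : E d) :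
    ContDiff ℝ (↑(⊤ : ℕ∞)) (atomHat ψ A ζ x) := by
  refine ContDiff.mul ?_ (ContDiff.cexp (ContDiff.mul ?_ contDiff_const))
  · refine Complex.ofRealCLM.contDiff.comp (ψ.contDiff.comp ?_)
    exact A.symm.contDiff.comp (contDiff_id.sub contDiff_const)
  · exact Complex.ofRealCLM.contDiff.comp (contDiff_const.mul (contDiff_id.inner ℝ contDiff_const))

/-- The Schwartz function with Fourier transform `atomHat`. -/
def atom (ψ : ContDiffBump (0 : E d)) (A : E d ≃L[ℝ] E d) (ζ x : E d) : 𝓢(E d, ℂ) :=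
  𝓕⁻ ((hasCompactSupport_atomHat ψ A ζ x).toSchwartzMap (contDiff_atomHat ψ A ζ x))

lemma fourier_atom (ψ : ContDiffBump (0 : E d)) (A : E d ≃L[ℝ] E d) (ζ x ξ : E d) :
    (𝓕 (atom ψ A ζ x) : 𝓢(E d, ℂ)) ξ = atomHat ψ A ζ x ξ := by
  rw [atom, FourierTransform.fourier_fourierInv_eq]
  rfl

/-- Substituting `ξ = A η + ζ` extracts the determinant and a unimodular factor; the remaining
integral depends on `y` only through `A* (y - x)`, which is why the atom concentrates on an
ellipsoid dual to that of its frequencies. -/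
lemma multiDeriv_atom (ψ : ContDiffBump (0 : E d)) (A : E d ≃L[ℝ] E d) (ζ x : E d) (j : Fin d)
    (k : ℕ) (y : E d) :
    multiDeriv (Pi.single j k) (atom ψ A ζ x) y =
      (detAbs A : ℂ) * (2 * Real.pi * Complex.I) ^ k *
        Complex.exp (↑(2 * Real.pi * inner ℝ ζ (y - x)) * Complex.I) *
        ∫ η, Complex.exp (↑(2 * Real.pi * inner ℝ η (adj A (y - x))) * Complex.I) *
          ((((A η + ζ) j) ^ k * ψ η : ℝ) : ℂ) := by
  rw [multiDeriv_single_eq_integral, ← integral_add_right_eq_self _ ζ, integral_comp_equiv A]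
  rw [mul_assoc (detAbs A : ℂ), mul_assoc (detAbs A : ℂ)]
  congr 1
  rw [← integral_const_mul]
  refine integral_congr_ae (Eventually.of_forall fun η => ?_)
  simp only [fourier_atom, atomHat, add_sub_cancel_right, ContinuousLinearEquiv.symm_apply_apply]
  have e : Complex.exp (↑(2 * Real.pi * inner ℝ (A η + ζ) y) * Complex.I) *
      Complex.exp (↑(-2 * Real.pi * inner ℝ (A η + ζ) x) * Complex.I) =
      Complex.exp (↑(2 * Real.pi * inner ℝ ζ (y - x)) * Complex.I) *
      Complex.exp (↑(2 * Real.pi * inner ℝ η (adj A (y - x))) * Complex.I) := by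
    rw [← Complex.exp_add, ← Complex.exp_add]
    congr 1
    rw [ContinuousLinearMap.adjoint_inner_right]
    simp only [ContinuousLinearEquiv.coe_coe, inner_add_left, inner_sub_right]
    push_cast
    ring
  rw [mul_pow, Complex.ofReal_mul (((A η + ζ) j) ^ k), Complex.ofReal_pow]
  linear_combination ((2 * Real.pi * Complex.I) ^ k * (((A η + ζ) j : ℝ) : ℂ) ^ k * (ψ η : ℂ)) * e

/-- The `L^p` norm of an atom. -/
lemma eLpNorm_atom (ψ : ContDiffBump (0 : E d)) (p : ℝ≥0∞) : ∃ K : ℝ≥0, ∀ (A : E d ≃L[ℝ] E d)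
    (ζ x : E d), eLpNorm (((detAbs A ^ ((1 / p).toReal - 1) : ℝ) : ℂ) • atom ψ A ζ x) p volume
      ≤ K := by
  -- All atoms are compared with this model: `|atom| = |det A| · |g (A* (y - x))|`, so their `L^p`
  -- norms scale like `|det A|^{1 - 1/p}`.
  set g : 𝓢(E d, ℂ) := atom ψ (ContinuousLinearEquiv.refl ℝ (E d)) 0 0 with hg
  refine ⟨(eLpNorm g p volume).toNNReal, fun A ζ x => ?_⟩
  rw [ENNReal.coe_toNNReal (g.eLpNorm_lt_top p volume).ne]
  have hD := detAbs_pos A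
  have hdet1 : detAbs (ContinuousLinearEquiv.refl ℝ (E d)) = 1 := by
    have : ((ContinuousLinearEquiv.refl ℝ (E d)).toLinearEquiv : E d →ₗ[ℝ] E d) =
      LinearMap.id := rfl
    rw [detAbs, this, LinearMap.det_id, abs_one]
  -- pointwise comparison with the model atom
  have hpt : ∀ y, ‖atom ψ A ζ x y‖ₑ = ‖((detAbs A : ℝ) : ℂ) • g (adj A (y - x))‖ₑ := by
    intro y
    -- For `d > 0` the formula for `∂_j^k` is used with `k = 0`, which needs some index `j`; in
    -- dimension `0` the claim is trivial.
    rcases Nat.eq_zero_or_pos d with rfl | hd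
    · rw [Subsingleton.elim ζ 0, Subsingleton.elim x 0, Subsingleton.elim (adj A (y - 0)) y]
      have hA : A = ContinuousLinearEquiv.refl ℝ (E 0) := by ext z i; exact i.elim0
      rw [hA, hdet1, ← hg]; simp
    · let j : Fin d := ⟨0, hd⟩
      have h0 : ∀ f : 𝓢(E d, ℂ), multiDeriv (Pi.single j 0) f = f := by
        intro f
        have e : multiDeriv (Pi.single j 0) f = 𝓕⁻ (𝓕 (multiDeriv (Pi.single j 0) f)) :=
          (FourierTransform.fourierInv_fourier_eq _).symm
        have e2 : (𝓕 (multiDeriv (Pi.single j 0) f) : 𝓢(E d, ℂ)) = 𝓕 f := by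
          ext ξ; rw [fourier_multiDeriv_single]; simp
        rw [e, e2, FourierTransform.fourierInv_fourier_eq]
      have hadj : adj (ContinuousLinearEquiv.refl ℝ (E d)) = ContinuousLinearMap.id ℝ (E d) := by
        have : ((ContinuousLinearEquiv.refl ℝ (E d) : E d ≃L[ℝ] E d) : E d →L[ℝ] E d) =
          ContinuousLinearMap.id ℝ (E d) := rfl
        rw [adj, this, ContinuousLinearMap.adjoint_id]
      rw [← h0 (atom ψ A ζ x), ← h0 g, hg, multiDeriv_atom, multiDeriv_atom, hdet1, hadj]
      simp only [enorm_mul, enorm_smul, pow_zero, inner_zero_left, sub_zero]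
      rw [← ofReal_norm (Complex.exp (↑(2 * Real.pi * inner ℝ ζ (y - x)) * Complex.I)),
        Complex.norm_exp_ofReal_mul_I]
      simp
  have h1 : eLpNorm (atom ψ A ζ x) p volume =
      ENNReal.ofReal (detAbs A) * (ENNReal.ofReal (detAbs A)⁻¹ ^ (1 / p).toReal *
        eLpNorm g p volume) := by
    have hmap : Measure.map (adj A) (volume : Measure (E d)) =
        ENNReal.ofReal (detAbs A)⁻¹ • volume := by
      have := Measure.map_linearMap_addHaar_eq_smul_addHaar (volume : Measure (E d))
        (f := (adj A : E d →ₗ[ℝ] E d)) (det_adj_ne_zero A)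
      rw [abs_inv, abs_det_adj] at this
      exact this
    have hc : ENNReal.ofReal (detAbs A)⁻¹ ≠ 0 := by simpa using hD
    have hmp : MeasurePreserving (fun y : E d => y - x) volume volume :=
      measurePreserving_sub_right volume x
    calc eLpNorm (atom ψ A ζ x) p volume
        = eLpNorm (((detAbs A : ℝ) : ℂ) • fun y => g (adj A (y - x))) p volume :=
          eLpNorm_congr_enorm_ae (Eventually.of_forall hpt)
      _ = ENNReal.ofReal (detAbs A) * eLpNorm ((g ∘ adj A) ∘ fun y => y - x) p volume := by
          rw [eLpNorm_const_smul, ← ofReal_norm, Complex.norm_real, Real.norm_of_nonneg hD.le]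
          rfl
      _ = _ := by
          rw [eLpNorm_comp_measurePreserving
            (g.continuous.comp (adj A).continuous).aestronglyMeasurable hmp,
            ← eLpNorm_map_measure g.continuous.aestronglyMeasurable
              (adj A).continuous.aemeasurable, hmap, eLpNorm_smul_measure_of_ne_zero hc,
            smul_eq_mul]
  have h2 : eLpNorm (((detAbs A ^ ((1 / p).toReal - 1) : ℝ) : ℂ) • (atom ψ A ζ x : E d → ℂ)) p
      volume = eLpNorm g p volume := by
    have hpos : 0 ≤ detAbs A ^ ((1 / p).toReal - 1) := by positivity
    rw [eLpNorm_const_smul, ← ofReal_norm, Complex.norm_real, Real.norm_of_nonneg hpos, h1,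
      ENNReal.ofReal_rpow_of_pos (by positivity), ← mul_assoc, ← mul_assoc,
      ← ENNReal.ofReal_mul hpos, ← ENNReal.ofReal_mul (by positivity)]
    have : detAbs A ^ ((1 / p).toReal - 1) * detAbs A * (detAbs A)⁻¹ ^ (1 / p).toReal = 1 := by
      rw [Real.rpow_sub_one hD.ne', Real.inv_rpow hD.le]
      have := (Real.rpow_pos_of_pos hD (1 / p).toReal).ne'
      field_simp
    rw [this]
    simp
  exact h2.le

/-- A lower bound for derivatives of atoms. -/
lemma le_norm_multiDeriv_atom (ψ : ContDiffBump (0 : E d)) (A : E d ≃L[ℝ] E d) (ζ x : E d)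
    (j : Fin d) (k : ℕ) {W s : ℝ} (hW : 0 ≤ W) (hs : s = 1 ∨ s = -1)
    (h : ∀ η : E d, ‖η‖ ≤ ψ.rOut → W ≤ s * (A η + ζ) j) (y : E d)
    (hy : ‖adj A (y - x)‖ ≤ 1 / (6 * ψ.rOut)) :
    detAbs A * ((2 * Real.pi) ^ k * (∫ η, ψ η) / 2) * W ^ k ≤
      ‖multiDeriv (Pi.single j k) (atom ψ A ζ x) y‖ := by
  set z := adj A (y - x) with hz
  set J := ∫ η, Complex.exp (↑(2 * Real.pi * inner ℝ η z) * Complex.I) *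
          ((((A η + ζ) j) ^ k * ψ η : ℝ) : ℂ) with hJ
  have hs1 : ‖((s ^ k : ℝ) : ℂ)‖ = 1 := by
    rw [Complex.norm_real, norm_pow]; rcases hs with rfl | rfl <;> simp
  have hr := ψ.rOut_pos
  have hcont : Continuous fun η => Complex.exp (↑(2 * Real.pi * inner ℝ η z) * Complex.I) *
          ((((A η + ζ) j) ^ k * ψ η : ℝ) : ℂ) := by
    have := ψ.continuous
    fun_prop
  have hint : Integrable fun η => Complex.exp (↑(2 * Real.pi * inner ℝ η z) * Complex.I) *
          ((((A η + ζ) j) ^ k * ψ η : ℝ) : ℂ) := by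
    refine hcont.integrable_of_hasCompactSupport ?_
    refine HasCompactSupport.mul_left ?_
    refine HasCompactSupport.comp_left (g := fun t : ℝ => (t : ℂ)) ?_ Complex.ofReal_zero
    exact ψ.hasCompactSupport.mul_left
  have hψi : Integrable fun η => W ^ k / 2 * ψ η := ψ.integrable.const_mul _
  -- No cancellation: on the support of `ψ` the phase is at most `2π · rOut / (6 rOut) = π/3`, so
  -- its cosine is at least `1/2`, while `s ^ k` makes the `k`-th power of the coordinate positive.
  have key : W ^ k / 2 * ∫ η, ψ η ≤ ‖J‖ := by
    calc W ^ k / 2 * ∫ η, ψ η = ∫ η, W ^ k / 2 * ψ η := (integral_const_mul _ _).symm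
      _ ≤ ∫ η, (((s ^ k : ℝ) : ℂ) * (Complex.exp (↑(2 * Real.pi * inner ℝ η z) * Complex.I) *
          ((((A η + ζ) j) ^ k * ψ η : ℝ) : ℂ))).re := by
          refine integral_mono hψi (hint.const_mul _).re fun η => ?_
          rw [Complex.re_ofReal_mul, Complex.re_mul_ofReal, Complex.exp_ofReal_mul_I_re]
          rcases le_or_gt ‖η‖ ψ.rOut with hη | hη
          · have h1 := h η hη
            have hcos : 1 / 2 ≤ Real.cos (2 * Real.pi * inner ℝ η z) := by
              rw [← Real.cos_pi_div_three, ← Real.cos_abs (2 * Real.pi * inner ℝ η z)]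
              refine Real.cos_le_cos_of_nonneg_of_le_pi (abs_nonneg _)
                (by linarith [Real.pi_pos]) ?_
              rw [abs_mul, abs_of_pos (by positivity : 0 < 2 * Real.pi)]
              calc 2 * Real.pi * |inner ℝ η z| ≤ 2 * Real.pi * (ψ.rOut * (1 / (6 * ψ.rOut))) := by
                    gcongr
                    exact (abs_real_inner_le_norm _ _).trans (by gcongr)
                _ = Real.pi / 3 := by field_simp; norm_num
            have h2 : W ^ k ≤ s ^ k * ((A η + ζ) j) ^ k := by
              rw [← mul_pow]; gcongr
            have h3 : 0 ≤ ψ η := ψ.nonneg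
            have h4 : 0 ≤ s ^ k * ((A η + ζ) j) ^ k := (pow_nonneg hW k).trans h2
            calc W ^ k / 2 * ψ η = W ^ k * (1 / 2) * ψ η := by ring
              _ ≤ (s ^ k * ((A η + ζ) j) ^ k) * Real.cos (2 * Real.pi * inner ℝ η z) * ψ η := by
                  gcongr
              _ = _ := by ring
          · have : ψ η = 0 := ψ.zero_of_le_dist (by simpa using hη.le)
            rw [this]; simp
      _ = (((s ^ k : ℝ) : ℂ) * J).re := by
          rw [hJ, ← integral_const_mul]
          exact (integral_re (hint.const_mul _))
      _ ≤ ‖((s ^ k : ℝ) : ℂ) * J‖ := Complex.re_le_norm _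
      _ = ‖J‖ := by rw [norm_mul, hs1, one_mul]
  rw [multiDeriv_atom, norm_mul, norm_mul, norm_mul, Complex.norm_exp_ofReal_mul_I, mul_one,
    Complex.norm_real, Real.norm_of_nonneg (detAbs_pos A).le]
  have h2 : ‖(2 * Real.pi * Complex.I : ℂ) ^ k‖ = (2 * Real.pi) ^ k := by
    rw [norm_pow]; simp [abs_of_pos Real.pi_pos]
  rw [h2]
  calc _ = detAbs A * (2 * Real.pi) ^ k * (W ^ k / 2 * ∫ η, ψ η) := by ring
    _ ≤ _ := by
      have := (detAbs_pos A).le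
      gcongr

lemma measure_setOf_norm_adj_le (A : E d ≃L[ℝ] E d) (x : E d) (δ : ℝ) :
    volume {y | ‖adj A (y - x)‖ ≤ δ} =
      ENNReal.ofReal (detAbs A)⁻¹ * volume (Metric.closedBall (0 : E d) δ) := by
  have h1 : {y | ‖adj A (y - x)‖ ≤ δ} =
      (fun y => y - x) ⁻¹' (adj A ⁻¹' Metric.closedBall (0 : E d) δ) := by
    ext y; simp
  rw [h1, (measurePreserving_sub_right volume x).measure_preimage
      ((Metric.isClosed_closedBall.preimage (adj A).continuous).measurableSet.nullMeasurableSet),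
    Measure.addHaar_preimage_continuousLinearMap volume (det_adj_ne_zero A), abs_inv, abs_det_adj]

/-- The inverse of `A*` is the adjoint of `A⁻¹` and has the same norm. This confines core sets to
balls. -/
lemma norm_le_of_norm_adj_le (A : E d ≃L[ℝ] E d) {M δ : ℝ}
    (hM : ‖(A.symm : E d →L[ℝ] E d)‖ ≤ M) (y : E d) (h : ‖adj A y‖ ≤ δ) : ‖y‖ ≤ M * δ := by
  have e : ContinuousLinearMap.adjoint (A.symm : E d →L[ℝ] E d) (adj A y) = y := by
    have : ((A : E d →L[ℝ] E d) ∘L (A.symm : E d →L[ℝ] E d)) = ContinuousLinearMap.id ℝ (E d) := by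
      ext z; simp
    have h2 := congrArg ContinuousLinearMap.adjoint this
    rw [ContinuousLinearMap.adjoint_comp, ContinuousLinearMap.adjoint_id] at h2
    exact congrArg (fun L : E d →L[ℝ] E d => L y) h2
  calc ‖y‖ = ‖ContinuousLinearMap.adjoint (A.symm : E d →L[ℝ] E d) (adj A y)‖ := by rw [e]
    _ ≤ ‖ContinuousLinearMap.adjoint (A.symm : E d →L[ℝ] E d)‖ * ‖adj A y‖ :=
        ContinuousLinearMap.le_opNorm _ _
    _ ≤ M * δ := by
        rw [LinearIsometryEquiv.norm_map]
        have := (norm_nonneg _).trans hM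
        gcongr

/-- Linear combinations of functions with Fourier transform supported in compact subsets of `O`. -/
lemma sum_smul_mem_schwartzO {I : Type*} {O : TopologicalSpace.Opens (E d)} (S : Finset I)
    (a : I → ℂ) (g : I → 𝓢(E d, ℂ)) (K : I → Set (E d)) (hK : ∀ l ∈ S, IsCompact (K l))
    (hKO : ∀ l ∈ S, K l ⊆ O) (hg : ∀ l ∈ S, ∀ ξ ∉ K l, (𝓕 (g l) : 𝓢(E d, ℂ)) ξ = 0) :
    ∑ l ∈ S, a l • g l ∈ schwartzO O := by
  have hKc : IsCompact (⋃ l ∈ S, K l) := S.isCompact_biUnion hK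
  have hz : ∀ ξ ∉ ⋃ l ∈ S, K l, (𝓕 (∑ l ∈ S, a l • g l) : 𝓢(E d, ℂ)) ξ = 0 := by
    intro ξ hξ
    rw [← FourierTransform.fourierCLM_apply (R := ℂ), map_sum]
    simp only [map_smul, sum_apply, smul_apply, FourierTransform.fourierCLM_apply]
    refine Finset.sum_eq_zero fun l hl => ?_
    rw [hg l hl ξ fun h => hξ (mem_biUnion hl h), smul_zero]
  refine ⟨HasCompactSupport.intro hKc hz, ?_⟩
  refine (closure_minimal (fun ξ hξ => ?_) hKc.isClosed).trans (iUnion₂_subset hKO)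
  by_contra h
  exact hξ (hz ξ h)

end Atoms

/-! ### Normalized atoms and the square function estimate. -/

section NormalizedAtoms

variable {d : ℕ} {I : Type*} {O : TopologicalSpace.Opens (E d)}

/-- The `L^p`-normalized atom. -/
def normAtom (p : ℝ≥0∞) (ψ : ContDiffBump (0 : E d)) (A : E d ≃L[ℝ] E d) (ζ x : E d) :
    𝓢(E d, ℂ) :=
  ((detAbs A ^ ((1 / p).toReal - 1) : ℝ) : ℂ) • atom ψ A ζ x

lemma fourier_normAtom_eq_zero (p : ℝ≥0∞) (ψ : ContDiffBump (0 : E d)) (A : E d ≃L[ℝ] E d)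
    (ζ x : E d) {ξ : E d} (h : ξ ∉ (fun η => A η + ζ) '' Metric.closedBall 0 ψ.rOut) :
    (𝓕 (normAtom p ψ A ζ x) : 𝓢(E d, ℂ)) ξ = 0 := by
  rw [normAtom, FourierTransform.fourier_smul, smul_apply, fourier_atom,
    atomHat_eq_zero ψ A ζ x h, smul_zero]

lemma multiDeriv_single_smul (j : Fin d) (k : ℕ) (a : ℂ) (g : 𝓢(E d, ℂ)) (y : E d) :
    multiDeriv (Pi.single j k) (a • g) y = a * multiDeriv (Pi.single j k) g y := by
  simpa using multiDeriv_single_sum j k {()} (fun _ => a) (fun _ => g) y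

/-- The constant in the lower bound for derivatives of normalized atoms. -/
def atomConst (ψ : ContDiffBump (0 : E d)) (k : ℕ) : ℝ := (2 * Real.pi) ^ k * (∫ η, ψ η) / 2

lemma atomConst_pos (ψ : ContDiffBump (0 : E d)) (k : ℕ) : 0 < atomConst ψ k := by
  have : 0 < ∫ η, ψ η := ψ.integral_pos
  have := Real.pi_pos
  unfold atomConst
  positivity

/-- The affine map `η ↦ A η + ζ` maps the support of the bump function `ψ` into `Q_l`, and there
the `j`-th coordinate has constant sign and modulus at least `W`. -/
def FitsInto (𝒬 : AffineFamily d I) (ψ : ContDiffBump (0 : E d)) (l : I) (j : Fin d)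
    (A : E d ≃L[ℝ] E d) (ζ : E d) (W : ℝ) : Prop :=
  0 ≤ W ∧ ∃ s : ℝ, (s = 1 ∨ s = -1) ∧
    ∀ η : E d, ‖η‖ ≤ ψ.rOut → A η + ζ ∈ 𝒬.Q l ∧ W ≤ s * (A η + ζ) j

lemma FitsInto.image_subset {𝒬 : AffineFamily d I} {ψ : ContDiffBump (0 : E d)} {l : I} {j : Fin d}
    {A : E d ≃L[ℝ] E d} {ζ : E d} {W : ℝ} (h : FitsInto 𝒬 ψ l j A ζ W) :
    (fun η => A η + ζ) '' Metric.closedBall 0 ψ.rOut ⊆ 𝒬.Q l := by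
  obtain ⟨-, s, -, hs⟩ := h
  rintro _ ⟨η, hη, rfl⟩
  exact (hs η (by simpa using hη)).1

lemma FitsInto.le_norm_multiDeriv {𝒬 : AffineFamily d I} {ψ : ContDiffBump (0 : E d)} {l : I}
    {j : Fin d} {A : E d ≃L[ℝ] E d} {ζ : E d} {W : ℝ} (h : FitsInto 𝒬 ψ l j A ζ W) (p : ℝ≥0∞)
    (k : ℕ) (x y : E d) (hy : ‖adj A (y - x)‖ ≤ 1 / (6 * ψ.rOut)) :
    atomConst ψ k * (detAbs A ^ (1 / p).toReal * W ^ k) ≤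
      ‖multiDeriv (Pi.single j k) (normAtom p ψ A ζ x) y‖ := by
  obtain ⟨hW, s, hs, H⟩ := h
  have hD := detAbs_pos A
  have h1 := le_norm_multiDeriv_atom ψ A ζ x j k hW hs (fun η hη => (H η hη).2) y hy
  have hpos : 0 ≤ detAbs A ^ ((1 / p).toReal - 1) := by positivity
  rw [normAtom, multiDeriv_single_smul, norm_mul, Complex.norm_real, Real.norm_of_nonneg hpos]
  calc _ = detAbs A ^ ((1 / p).toReal - 1) *
        (detAbs A * ((2 * Real.pi) ^ k * (∫ η, ψ η) / 2) * W ^ k) := by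
        rw [atomConst, Real.rpow_sub_one hD.ne']
        field_simp
    _ ≤ _ := by gcongr

variable {𝒬 : AffineFamily d I} {φ : I → 𝓓(O, ℂ)} {p q : ℝ≥0∞} {Y : SequenceSpace I} {k : ℕ}

/-- Boundedness of the derivatives of order `k`, tested on sums of atoms. -/
theorem exists_eLpNorm_sum_atoms_le (hp : 0 < p) (h : 𝒬.IsSemiStructured (O : Set (E d)))
    (hφ : 𝒬.IsBAPU p φ) (hY : Y.IsRegular 𝒬)
    (hbdd : ∀ α : Fin d → ℕ, ∑ j, α j = k → DerivBounded φ p q Y α)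
    (ψ : ContDiffBump (0 : E d)) :
    ∃ C : ℝ≥0, ∀ (A : I → (E d ≃L[ℝ] E d)) (ζ x : I → E d) (W : I → ℝ) (j : Fin d)
      (S : Finset I) (c : Y.carrier) (a : I → ℂ), (∀ l ∈ S, FitsInto 𝒬 ψ l j (A l) (ζ l) (W l)) →
      (∀ l ∈ S, ‖a l‖ ≤ ‖(c : I → ℂ) l‖) →
      eLpNorm (multiDeriv (Pi.single j k)
        (∑ l ∈ S, a l • normAtom p ψ (A l) (ζ l) (x l))) q volume ≤
          C * ENNReal.ofReal (Y.qnorm c) := by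
  obtain ⟨K, hK⟩ := eLpNorm_atom ψ p
  obtain ⟨C₁, hC₁⟩ := exists_decompNorm_sum_le hp h hφ hY K
  have hb : ∀ j : Fin d, DerivBounded φ p q Y (Pi.single j k) := fun j =>
    hbdd _ (by simp)
  -- There are only `d` pure derivatives of order `k`, so summing their constants gives one that is
  -- uniform in `j`.
  choose C₂ hC₂ using hb
  refine ⟨(∑ j, C₂ j) * C₁, fun A ζ x W j S c a hfit ha => ?_⟩
  have hdec : decompNorm φ p Y (∑ l ∈ S, a l • normAtom p ψ (A l) (ζ l) (x l)) ≤
      C₁ * ENNReal.ofReal (Y.qnorm c) := by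
    refine hC₁ _ S c a (fun l hl ξ hξ => ?_) (fun l _ => hK _ _ _) ha
    exact fourier_normAtom_eq_zero p ψ _ _ _ fun h' => hξ ((hfit l hl).image_subset h')
  have hQO : ∀ l, 𝒬.Q l ⊆ O := fun l => by
    rw [← h.covers]; exact subset_iUnion _ l
  have hmem : ∑ l ∈ S, a l • normAtom p ψ (A l) (ζ l) (x l) ∈ schwartzOpY φ p Y := by
    refine ⟨sum_smul_mem_schwartzO S a _
      (fun l => (fun η => A l η + ζ l) '' Metric.closedBall 0 ψ.rOut)
      (fun l _ => isCompact_image_closedBall _ _ _)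
      (fun l hl => (hfit l hl).image_subset.trans (hQO l))
      (fun l _ ξ hξ => fourier_normAtom_eq_zero p ψ _ _ _ hξ), ?_⟩
    exact hdec.trans_lt (ENNReal.mul_lt_top ENNReal.coe_lt_top ENNReal.ofReal_lt_top)
  refine (hC₂ j _ hmem).trans ?_
  calc (C₂ j : ℝ≥0∞) * _ ≤ (∑ j, C₂ j : ℝ≥0) * (C₁ * ENNReal.ofReal (Y.qnorm c)) := by
        gcongr
        exact Finset.single_le_sum (f := C₂) (fun _ _ => zero_le) (Finset.mem_univ j)
    _ = _ := by push_cast; ring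

/-- The set where the derivatives of an atom are bounded below. -/
def coreSet (ψ : ContDiffBump (0 : E d)) (A : E d ≃L[ℝ] E d) (x : E d) : Set (E d) :=
  {y | ‖adj A (y - x)‖ ≤ 1 / (6 * ψ.rOut)}

lemma measurableSet_coreSet (ψ : ContDiffBump (0 : E d)) (A : E d ≃L[ℝ] E d) (x : E d) :
    MeasurableSet (coreSet ψ A x) :=
  (isClosed_le (by fun_prop) continuous_const).measurableSet

/-- Square function estimate. -/
theorem exists_lintegral_squareFunction_le (hp : 0 < p) (hq : 0 < q) (hqt : q ≠ ∞)
    (h : 𝒬.IsSemiStructured (O : Set (E d))) (hφ : 𝒬.IsBAPU p φ) (hY : Y.IsRegular 𝒬)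
    (hbdd : ∀ α : Fin d → ℕ, ∑ j, α j = k → DerivBounded φ p q Y α)
    (ψ : ContDiffBump (0 : E d)) :
    -- The constant is independent of `A` and `x`: the centres will depend on the finite set `S`,
    -- and the maps need not be the `T_l`.
    ∃ C : ℝ≥0, ∀ (A : I → (E d ≃L[ℝ] E d)) (ζ x : I → E d) (W : I → ℝ) (j : Fin d)
      (S : Finset I) (c : Y.carrier), (∀ l ∈ S, FitsInto 𝒬 ψ l j (A l) (ζ l) (W l)) →
      ∫⁻ y, ENNReal.ofReal ((∑ l ∈ S, (coreSet ψ (A l) (x l)).indicator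
        (fun _ => (‖(c : I → ℂ) l‖ * (detAbs (A l) ^ (1 / p).toReal * W l ^ k)) ^ 2) y) ^
          (q.toReal / 2)) ≤ C * ENNReal.ofReal (Y.qnorm c) ^ q.toReal := by
  classical
  obtain ⟨C, hC⟩ := exists_eLpNorm_sum_atoms_le hp h hφ hY hbdd ψ
  have hr : 0 < q.toReal := ENNReal.toReal_pos hq.ne' hqt
  set r := q.toReal with hrdef
  obtain ⟨κ, hκ, hkh⟩ := exists_khintchine (ι := I) hr
  set m := atomConst ψ k with hm
  have hm0 : 0 < m := atomConst_pos ψ k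
  have hK0 : 0 < κ * (m ^ 2) ^ (r / 2) := by positivity
  refine ⟨(κ * (m ^ 2) ^ (r / 2))⁻¹.toNNReal * C ^ r, fun A ζ x W j S c hfit => ?_⟩
  set G : I → E d → ℂ :=
    fun l y => multiDeriv (Pi.single j k) (normAtom p ψ (A l) (ζ l) (x l)) y with hG
  set H : E d → ℝ := fun y => ∑ l ∈ S, (coreSet ψ (A l) (x l)).indicator
        (fun _ => (‖(c : I → ℂ) l‖ * (detAbs (A l) ^ (1 / p).toReal * W l ^ k)) ^ 2) y with hH
  have hH0 : ∀ y, 0 ≤ H y := fun y => Finset.sum_nonneg fun l _ =>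
    indicator_nonneg (fun _ _ => by positivity) _
  -- pointwise bound
  have pt : ∀ y, 2 ^ S.card * (κ * (m ^ 2) ^ (r / 2) * H y ^ (r / 2)) ≤
      ∑ t ∈ S.powerset, ‖signedSum S t (fun l => (c : I → ℂ) l * G l y)‖ ^ r := by
    intro y
    refine le_trans ?_ (hkh S _)
    rw [mul_assoc κ, ← Real.mul_rpow (by positivity) (hH0 y)]
    gcongr
    · exact mul_nonneg (by positivity) (hH0 y)
    · rw [hH, Finset.mul_sum]
      refine Finset.sum_le_sum fun l hl => ?_
      by_cases hy : y ∈ coreSet ψ (A l) (x l)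
      · rw [indicator_of_mem hy, ← mul_pow, norm_mul]
        have h1 := (hfit l hl).le_norm_multiDeriv p k (x l) y hy
        have hW := (hfit l hl).1
        have hD := detAbs_pos (A l)
        refine pow_le_pow_left₀ (by positivity) ?_ 2
        calc _ = ‖(c : I → ℂ) l‖ * (m * (detAbs (A l) ^ (1 / p).toReal * W l ^ k)) := by ring
          _ ≤ ‖(c : I → ℂ) l‖ * ‖G l y‖ := mul_le_mul_of_nonneg_left h1 (norm_nonneg _)
      · rw [indicator_of_notMem hy, mul_zero]; positivity
  have hsigned : ∀ t y, signedSum S t (fun l => (c : I → ℂ) l * G l y) =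
      multiDeriv (Pi.single j k) (∑ l ∈ S, (if l ∈ t then (c : I → ℂ) l else -(c : I → ℂ) l) •
        normAtom p ψ (A l) (ζ l) (x l)) y := by
    intro t y
    rw [multiDeriv_single_sum, signedSum]
    refine Finset.sum_congr rfl fun l _ => ?_
    split_ifs <;> simp [hG]
  -- Sign changes preserve the moduli of the coefficients, so each choice of signs obeys the same
  -- bound.
  have hint : ∀ t, ∫⁻ y, ENNReal.ofReal
      (‖signedSum S t (fun l => (c : I → ℂ) l * G l y)‖ ^ r) ≤
      (C * ENNReal.ofReal (Y.qnorm c)) ^ r := by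
    intro t
    have h1 := hC A ζ x W j S c (fun l => if l ∈ t then (c : I → ℂ) l else -(c : I → ℂ) l) hfit
      (fun l _ => by split_ifs <;> simp)
    rw [eLpNorm_eq_lintegral_rpow_enorm_toReal hq.ne' hqt, ← hrdef] at h1
    have h2 := ENNReal.rpow_le_rpow h1 hr.le
    rw [← ENNReal.rpow_mul, one_div_mul_cancel hr.ne', ENNReal.rpow_one] at h2
    refine le_trans (le_of_eq (lintegral_congr fun y => ?_)) h2
    rw [hsigned, ← ENNReal.ofReal_rpow_of_nonneg (norm_nonneg _) hr.le, ofReal_norm]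
  have hmeas : ∀ t, Measurable fun y => ENNReal.ofReal
      (‖signedSum S t (fun l => (c : I → ℂ) l * G l y)‖ ^ r) := by
    intro t
    simp only [hsigned]
    exact ((SchwartzMap.continuous _).norm.measurable.pow_const r).ennreal_ofReal
  -- Summation over all `2 ^ S.card` signs; this count then cancels from both sides.
  have htot : ENNReal.ofReal (2 ^ S.card * (κ * (m ^ 2) ^ (r / 2))) *
      ∫⁻ y, ENNReal.ofReal (H y ^ (r / 2)) ≤
      ENNReal.ofReal (2 ^ S.card) * (C * ENNReal.ofReal (Y.qnorm c)) ^ r := by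
    calc _ = ∫⁻ y, ENNReal.ofReal (2 ^ S.card * (κ * (m ^ 2) ^ (r / 2) * H y ^ (r / 2))) := by
          rw [← lintegral_const_mul' _ _ ENNReal.ofReal_ne_top]
          refine lintegral_congr fun y => ?_
          rw [← ENNReal.ofReal_mul (by positivity), mul_assoc]
      _ ≤ ∫⁻ y, ∑ t ∈ S.powerset, ENNReal.ofReal
            (‖signedSum S t (fun l => (c : I → ℂ) l * G l y)‖ ^ r) := by
          refine lintegral_mono fun y => ?_
          rw [← ENNReal.ofReal_sum_of_nonneg fun _ _ => by positivity]
          exact ENNReal.ofReal_le_ofReal (pt y)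
      _ = ∑ t ∈ S.powerset, ∫⁻ y, ENNReal.ofReal
            (‖signedSum S t (fun l => (c : I → ℂ) l * G l y)‖ ^ r) :=
          lintegral_finsetSum _ fun t _ => hmeas t
      _ ≤ ∑ t ∈ S.powerset, (C * ENNReal.ofReal (Y.qnorm c)) ^ r :=
          Finset.sum_le_sum fun t _ => hint t
      _ = _ := by
          rw [Finset.sum_const, Finset.card_powerset, nsmul_eq_mul,
            ENNReal.ofReal_pow (by norm_num)]
          push_cast
          norm_num
  have h2pos : ENNReal.ofReal ((2 : ℝ) ^ S.card) ≠ 0 := by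
    rw [ENNReal.ofReal_ne_zero_iff]; positivity
  rw [ENNReal.ofReal_mul (by positivity), mul_assoc,
    ENNReal.mul_le_mul_iff_right h2pos ENNReal.ofReal_ne_top] at htot
  have hinv : ENNReal.ofReal (κ * (m ^ 2) ^ (r / 2))⁻¹ *
      ENNReal.ofReal (κ * (m ^ 2) ^ (r / 2)) = 1 := by
    rw [← ENNReal.ofReal_mul (by positivity), inv_mul_cancel₀ hK0.ne', ENNReal.ofReal_one]
  calc ∫⁻ y, ENNReal.ofReal (H y ^ (r / 2))
      = ENNReal.ofReal (κ * (m ^ 2) ^ (r / 2))⁻¹ * (ENNReal.ofReal (κ * (m ^ 2) ^ (r / 2)) *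
        ∫⁻ y, ENNReal.ofReal (H y ^ (r / 2))) := by rw [← mul_assoc, hinv, one_mul]
    _ ≤ ENNReal.ofReal (κ * (m ^ 2) ^ (r / 2))⁻¹ * (C * ENNReal.ofReal (Y.qnorm c)) ^ r := by
        gcongr
    _ = _ := by
        rw [ENNReal.mul_rpow_of_nonneg _ _ hr.le, ENNReal.ofReal]
        push_cast
        rw [← ENNReal.coe_rpow_of_nonneg _ hr.le]
        ring

end NormalizedAtoms

/-! ### The embeddings into weighted sequence spaces. -/

section Embeddings

variable {d : ℕ} {I : Type*} {O : TopologicalSpace.Opens (E d)}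

/-- To obtain an embedding, it suffices to estimate the sums over the fibers of a map into a finite
set. -/
lemma finSuppEmbeds_of_sum_le {Y : SequenceSpace I} {J : Set I} {u : I → ℝ} (hu : ∀ i, 0 ≤ u i)
    {r : ℝ≥0∞} (hr0 : r ≠ 0) (hrt : r ≠ ∞) (jf : I → Fin d)
    (h : ∃ C : ℝ≥0, ∀ (j : Fin d) (S : Finset I) (c : Y.carrier), (∀ l ∈ S, jf l = j) →
      (∀ l ∈ S, l ∈ J) → ∑ l ∈ S, ENNReal.ofReal ((u l * ‖(c : I → ℂ) l‖) ^ r.toReal) ≤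
        C * ENNReal.ofReal (Y.qnorm c) ^ r.toReal) : FinSuppEmbeds Y J u r := by
  classical
  obtain ⟨C, hC⟩ := h
  have hr : 0 < r.toReal := ENNReal.toReal_pos hr0 hrt
  refine ⟨(d * C) ^ (1 / r.toReal), fun c hfin hsub => ?_⟩
  suffices hle : weightedSeqNorm u r c ≤
      ((d * C) ^ (1 / r.toReal) : ℝ≥0) * ENNReal.ofReal (Y.qnorm c) from
    ⟨hle.trans_lt (ENNReal.mul_lt_top ENNReal.coe_lt_top ENNReal.ofReal_lt_top), hle⟩
  rw [weightedSeqNorm, seqNorm, if_neg hrt]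
  have hterm : ∀ l, ‖(u l : ℂ) * (c : I → ℂ) l‖ₑ ^ r.toReal =
      ENNReal.ofReal ((u l * ‖(c : I → ℂ) l‖) ^ r.toReal) := fun l => by
    rw [← ofReal_norm, norm_mul, Complex.norm_real, Real.norm_of_nonneg (hu l),
      ENNReal.ofReal_rpow_of_nonneg (mul_nonneg (hu l) (norm_nonneg _)) hr.le]
  have hsum : ∑' l, ‖(u l : ℂ) * (c : I → ℂ) l‖ₑ ^ r.toReal ≤
      ((d * C : ℝ≥0) : ℝ≥0∞) * ENNReal.ofReal (Y.qnorm c) ^ r.toReal := by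
    rw [tsum_eq_sum (s := hfin.toFinset) fun l hl => by
      have : (c : I → ℂ) l = 0 := by simpa using hl
      rw [this, mul_zero, enorm_zero, ENNReal.zero_rpow_of_pos hr]]
    simp only [hterm]
    rw [← Finset.sum_fiberwise hfin.toFinset jf]
    calc _ ≤ ∑ _j : Fin d, (C : ℝ≥0∞) * ENNReal.ofReal (Y.qnorm c) ^ r.toReal := by
          refine Finset.sum_le_sum fun j _ => hC j _ c (fun l hl => (Finset.mem_filter.1 hl).2)
            fun l hl => hsub ?_
          simpa using (Finset.mem_filter.1 hl).1
      _ = _ := by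
          rw [Finset.sum_const, Finset.card_univ, Fintype.card_fin, nsmul_eq_mul]
          push_cast
          ring
  calc _ ≤ (((d * C : ℝ≥0) : ℝ≥0∞) * ENNReal.ofReal (Y.qnorm c) ^ r.toReal) ^ (1 / r.toReal) := by
        gcongr
    _ = _ := by
        rw [ENNReal.mul_rpow_of_nonneg _ _ (by positivity), ← ENNReal.rpow_mul,
          mul_one_div_cancel hr.ne', ENNReal.rpow_one, ENNReal.coe_rpow_of_nonneg _ (by positivity)]

lemma FinSuppEmbeds.top_of_one {Y : SequenceSpace I} {J : Set I} {u : I → ℝ}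
    (h : FinSuppEmbeds Y J u 1) : FinSuppEmbeds Y J u ∞ := by
  obtain ⟨C, hC⟩ := h
  have hle : ∀ x : I → ℂ, weightedSeqNorm u ∞ x ≤ weightedSeqNorm u 1 x := fun x => by
    simp only [weightedSeqNorm, seqNorm, if_true, ENNReal.one_ne_top, if_false,
      ENNReal.toReal_one, ENNReal.rpow_one, div_one]
    exact iSup_le fun i => ENNReal.le_tsum i
  exact ⟨C, fun c hf hs => ⟨(hle _).trans_lt (hC c hf hs).1, (hle _).trans (hC c hf hs).2⟩⟩

variable {𝒬 : AffineFamily d I}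

lemma weight_nonneg (𝒬 : AffineFamily d I) (k : ℕ) (p q : ℝ≥0∞) (i : I) :
    0 ≤ 𝒬.weight k p q i := by
  have h1 : 0 ≤ 𝒬.absDet i := abs_nonneg _
  have h2 : 0 ≤ 𝒬.normT i := norm_nonneg _
  unfold AffineFamily.weight
  positivity

/-- Brings the weight into the shape of the lower bound for atoms, with `W = κ (‖b‖ + ‖T‖)`. -/
lemma weight_le (𝒬 : AffineFamily d I) (k : ℕ) (p q : ℝ≥0∞) {κ : ℝ} (hκ : 0 < κ) (i : I) :
    𝒬.weight k p q i ≤ 2 / κ ^ k * (detAbs (𝒬.T i) ^ ((1 / p).toReal - (1 / q).toReal) *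
      (κ * (‖𝒬.b i‖ + 𝒬.normT i)) ^ k) := by
  have h2 : 0 ≤ 𝒬.normT i := norm_nonneg _
  have h3 := norm_nonneg (𝒬.b i)
  have hD := detAbs_pos (𝒬.T i)
  have hsum : ‖𝒬.b i‖ ^ k + 𝒬.normT i ^ k ≤ 2 * (‖𝒬.b i‖ + 𝒬.normT i) ^ k := by
    have h4 : ‖𝒬.b i‖ ^ k ≤ (‖𝒬.b i‖ + 𝒬.normT i) ^ k := by gcongr; linarith
    have h5 : 𝒬.normT i ^ k ≤ (‖𝒬.b i‖ + 𝒬.normT i) ^ k := by gcongr; linarith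
    linarith
  calc 𝒬.weight k p q i = detAbs (𝒬.T i) ^ ((1 / p).toReal - (1 / q).toReal) *
        (‖𝒬.b i‖ ^ k + 𝒬.normT i ^ k) := rfl
    _ ≤ detAbs (𝒬.T i) ^ ((1 / p).toReal - (1 / q).toReal) *
        (2 * (‖𝒬.b i‖ + 𝒬.normT i) ^ k) := by gcongr
    _ = _ := by rw [mul_pow]; field_simp

lemma volume_coreSet (ψ : ContDiffBump (0 : E d)) (A : E d ≃L[ℝ] E d) (x : E d) :
    volume (coreSet ψ A x) = ENNReal.ofReal (detAbs A)⁻¹ *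
      volume (Metric.closedBall (0 : E d) (1 / (6 * ψ.rOut))) :=
  measure_setOf_norm_adj_le A x _

lemma volume_coreBall_ne_zero (ψ : ContDiffBump (0 : E d)) :
    volume (Metric.closedBall (0 : E d) (1 / (6 * ψ.rOut))) ≠ 0 := by
  have := ψ.rOut_pos
  exact (Metric.measure_closedBall_pos _ _ (by positivity)).ne'

/-- Finitely many core sets can be made disjoint by translations. -/
lemma exists_disjoint_coreSet (hd : 1 ≤ d) (ψ : ContDiffBump (0 : E d)) (A : I → (E d ≃L[ℝ] E d))
    (S : Finset I) : ∃ x : I → E d, ∀ l ∈ S, ∀ m ∈ S, l ≠ m →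
      Disjoint (coreSet ψ (A l) (x l)) (coreSet ψ (A m) (x m)) := by
  set δ := 1 / (6 * ψ.rOut) with hδ
  have hδ0 : 0 < δ := by have := ψ.rOut_pos; positivity
  set M : ℝ := ∑ l ∈ S, ‖((A l).symm : E d →L[ℝ] E d)‖ with hM
  have hM0 : 0 ≤ M := Finset.sum_nonneg fun _ _ => norm_nonneg _
  obtain ⟨n, hn⟩ := Set.countable_iff_exists_injOn.1 S.countable_toSet
  set e : E d := EuclideanSpace.single ⟨0, hd⟩ 1 with he
  have he1 : ‖e‖ = 1 := by simp [he]
  -- Each core lies within `M δ` of its centre, so spacing the centres by more than `2 M δ` along a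
  -- line suffices.
  refine ⟨fun l => ((n l : ℝ) * (2 * (M * δ) + 1)) • e, fun l hl m hm hlm => ?_⟩
  rw [Set.disjoint_left]
  intro y hy1 hy2
  have hb : ∀ l ∈ S, ∀ z, ‖adj (A l) z‖ ≤ δ → ‖z‖ ≤ M * δ := fun l hl z hz =>
    norm_le_of_norm_adj_le (A l) (Finset.single_le_sum
      (f := fun l => ‖((A l).symm : E d →L[ℝ] E d)‖) (fun _ _ => norm_nonneg _) hl) z hz
  have h1 := hb l hl _ hy1
  have h2 := hb m hm _ hy2
  have hne : n l ≠ n m := fun h => hlm (hn hl hm h)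
  have h3 : (1 : ℝ) ≤ |(n l : ℝ) - n m| := by
    have : (1 : ℤ) ≤ |(n l : ℤ) - n m| := Int.one_le_abs (sub_ne_zero.2 (by exact_mod_cast hne))
    exact_mod_cast this
  have h4 : ‖((n l : ℝ) * (2 * (M * δ) + 1)) • e - ((n m : ℝ) * (2 * (M * δ) + 1)) • e‖ =
      |(n l : ℝ) - n m| * (2 * (M * δ) + 1) := by
    rw [← sub_smul, ← sub_mul, norm_smul, he1, mul_one, Real.norm_eq_abs, abs_mul,
      abs_of_pos (by positivity : 0 < 2 * (M * δ) + 1)]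
  have h5 : ‖((n l : ℝ) * (2 * (M * δ) + 1)) • e - ((n m : ℝ) * (2 * (M * δ) + 1)) • e‖ ≤
      M * δ + M * δ := by
    refine le_trans (le_of_eq ?_) ((norm_sub_le (y - ((n m : ℝ) * (2 * (M * δ) + 1)) • e)
      (y - ((n l : ℝ) * (2 * (M * δ) + 1)) • e)).trans (add_le_add h2 h1))
    congr 1; abel
  rw [h4] at h5
  nlinarith [mul_nonneg hM0 hδ0.le]

variable {φ : I → 𝓓(O, ℂ)} {p q : ℝ≥0∞} {Y : SequenceSpace I} {k : ℕ}

/-- With pairwise disjoint cores, the square function on the `l`-th core equals `β l`, so its `L^q`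
integral is at least `∑ β_l^q |core_l|`. The core volume `≈ |det T_l|⁻¹` turns the exponent `1/p`
into `1/p - 1/q`. Thanks to the random signs, the tails of the atoms need no estimate. -/
theorem finSuppEmbeds_weight_self (hd : 1 ≤ d) (hp : 0 < p) (hq : 0 < q) (hqt : q ≠ ∞)
    (h : 𝒬.IsSemiStructured (O : Set (E d))) (hφ : 𝒬.IsBAPU p φ) (hY : Y.IsRegular 𝒬)
    (hbdd : ∀ α : Fin d → ℕ, ∑ j, α j = k → DerivBounded φ p q Y α)
    {ψ : ContDiffBump (0 : E d)} {κ : ℝ} (hκ : 0 < κ) {jf : I → Fin d} {ζ : I → E d}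
    (hfit : ∀ l, FitsInto 𝒬 ψ l (jf l) (𝒬.T l) (ζ l) (κ * (‖𝒬.b l‖ + 𝒬.normT l))) :
    FinSuppEmbeds Y univ (𝒬.weight k p q) q := by
  classical
  refine finSuppEmbeds_of_sum_le (weight_nonneg 𝒬 k p q) hq.ne' hqt jf ?_
  obtain ⟨C, hC⟩ := exists_lintegral_squareFunction_le hp hq hqt h hφ hY hbdd ψ
  have hr : 0 < q.toReal := ENNReal.toReal_pos hq.ne' hqt
  set v := volume (Metric.closedBall (0 : E d) (1 / (6 * ψ.rOut))) with hv
  have hv0 : v ≠ 0 := volume_coreBall_ne_zero ψ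
  have hvt : v ≠ ∞ := measure_closedBall_lt_top.ne
  set r := q.toReal with hrdef
  refine ⟨((2 / κ ^ k) ^ r).toNNReal * v⁻¹.toNNReal * C, fun j S c hj _ => ?_⟩
  obtain ⟨x, hx⟩ := exists_disjoint_coreSet hd ψ 𝒬.T S
  set W : I → ℝ := fun l => κ * (‖𝒬.b l‖ + 𝒬.normT l) with hW
  have hW0 : ∀ l, 0 ≤ W l := fun l => (hfit l).1
  have main := hC 𝒬.T ζ x W j S c fun l hl => hj l hl ▸ hfit l
  set β : I → ℝ := fun l => ‖(c : I → ℂ) l‖ * (detAbs (𝒬.T l) ^ (1 / p).toReal * W l ^ k) with hβ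
  have hβ0 : ∀ l, 0 ≤ β l := fun l => by
    have := (detAbs_pos (𝒬.T l)).le
    have := hW0 l
    positivity
  have lower : ∑ l ∈ S, ENNReal.ofReal (β l ^ r) * (ENNReal.ofReal (detAbs (𝒬.T l))⁻¹ * v) ≤
      C * ENNReal.ofReal (Y.qnorm c) ^ r := by
    refine le_trans ?_ main
    calc _ = ∑ l ∈ S, ∫⁻ y, (coreSet ψ (𝒬.T l) (x l)).indicator
            (fun _ => ENNReal.ofReal (β l ^ r)) y := by
          refine Finset.sum_congr rfl fun l _ => ?_
          rw [lintegral_indicator_const (measurableSet_coreSet ψ _ _), volume_coreSet]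
      _ = ∫⁻ y, ∑ l ∈ S, (coreSet ψ (𝒬.T l) (x l)).indicator
            (fun _ => ENNReal.ofReal (β l ^ r)) y :=
          (lintegral_finsetSum _ fun l _ =>
            measurable_const.indicator (measurableSet_coreSet ψ _ _)).symm
      _ ≤ _ := by
          refine lintegral_mono fun y => ?_
          by_cases hy : ∃ m ∈ S, y ∈ coreSet ψ (𝒬.T m) (x m)
          · obtain ⟨m, hmS, hm⟩ := hy
            rw [Finset.sum_eq_single_of_mem m hmS fun l hl hlm =>
              indicator_of_notMem (Set.disjoint_left.1 (hx m hmS l hl hlm.symm) hm) _,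
              indicator_of_mem hm]
            refine ENNReal.ofReal_le_ofReal ?_
            calc β m ^ r = (β m ^ 2) ^ (r / 2) := by
                  rw [← Real.rpow_natCast (β m) 2, ← Real.rpow_mul (hβ0 m)]
                  congr 1; push_cast; ring
              _ ≤ _ := by
                  gcongr
                  have h1 := Finset.single_le_sum (f := fun l => (coreSet ψ (𝒬.T l) (x l)).indicator
                    (fun _ => β l ^ 2) y) (fun l _ => indicator_nonneg (fun _ _ => by positivity) _)
                    hmS
                  simpa only [indicator_of_mem hm] using h1
          · rw [Finset.sum_eq_zero fun l hl => indicator_of_notMem (fun hm => hy ⟨l, hl, hm⟩) _]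
            exact zero_le
  have hterm : ∀ l, ENNReal.ofReal ((𝒬.weight k p q l * ‖(c : I → ℂ) l‖) ^ r) ≤
      ENNReal.ofReal ((2 / κ ^ k) ^ r) * v⁻¹ * (ENNReal.ofReal (β l ^ r) *
        (ENNReal.ofReal (detAbs (𝒬.T l))⁻¹ * v)) := by
    intro l
    have hD := detAbs_pos (𝒬.T l)
    have hWl := hW0 l
    have e1 : (𝒬.weight k p q l * ‖(c : I → ℂ) l‖) ^ r ≤
        (2 / κ ^ k) ^ r * (β l ^ r * (detAbs (𝒬.T l))⁻¹) := by
      calc _ ≤ ((2 / κ ^ k) * (detAbs (𝒬.T l) ^ ((1 / p).toReal - (1 / q).toReal) *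
              W l ^ k) * ‖(c : I → ℂ) l‖) ^ r := by
            have := weight_nonneg 𝒬 k p q l
            gcongr
            exact weight_le 𝒬 k p q hκ l
        _ = ((2 / κ ^ k) * (β l * detAbs (𝒬.T l) ^ (-(1 / q).toReal))) ^ r := by
            rw [sub_eq_add_neg, Real.rpow_add hD]
            congr 1
            simp only [hβ]
            ring
        _ = _ := by
            rw [Real.mul_rpow (by positivity) (mul_nonneg (hβ0 l) (by positivity)),
              Real.mul_rpow (hβ0 l) (by positivity), ← Real.rpow_mul hD.le]
            have : -(1 / q).toReal * r = -1 := by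
              rw [ENNReal.toReal_div, ENNReal.toReal_one, ← hrdef]
              field_simp
            rw [this, Real.rpow_neg_one]
    calc _ ≤ ENNReal.ofReal ((2 / κ ^ k) ^ r * (β l ^ r * (detAbs (𝒬.T l))⁻¹)) :=
          ENNReal.ofReal_le_ofReal e1
      _ = ENNReal.ofReal ((2 / κ ^ k) ^ r) * (ENNReal.ofReal (β l ^ r) *
            ENNReal.ofReal (detAbs (𝒬.T l))⁻¹) * (v⁻¹ * v) := by
          have := hβ0 l
          rw [ENNReal.inv_mul_cancel hv0 hvt, mul_one, ENNReal.ofReal_mul (by positivity),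
            ENNReal.ofReal_mul (by positivity)]
      _ = _ := by ring
  calc _ ≤ ∑ l ∈ S, ENNReal.ofReal ((2 / κ ^ k) ^ r) * v⁻¹ * (ENNReal.ofReal (β l ^ r) *
        (ENNReal.ofReal (detAbs (𝒬.T l))⁻¹ * v)) := Finset.sum_le_sum fun l _ => hterm l
    _ ≤ ENNReal.ofReal ((2 / κ ^ k) ^ r) * v⁻¹ * (C * ENNReal.ofReal (Y.qnorm c) ^ r) := by
        rw [← Finset.mul_sum]
        gcongr
    _ = _ := by
        push_cast
        rw [ENNReal.coe_toNNReal (ENNReal.inv_ne_top.2 hv0), ENNReal.ofReal]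
        ring

/-- All atoms are centred at `0` and the coefficients are rotated so that the derivatives add up
without cancellation there; the supremum norm dominates this single value. -/
theorem finSuppEmbeds_weight_one (hp : 0 < p)
    (h : 𝒬.IsSemiStructured (O : Set (E d))) (hφ : 𝒬.IsBAPU p φ) (hY : Y.IsRegular 𝒬)
    (hbdd : ∀ α : Fin d → ℕ, ∑ j, α j = k → DerivBounded φ p ∞ Y α)
    {ψ : ContDiffBump (0 : E d)} {κ : ℝ} (hκ : 0 < κ) {jf : I → Fin d} {ζ : I → E d}
    (hfit : ∀ l, FitsInto 𝒬 ψ l (jf l) (𝒬.T l) (ζ l) (κ * (‖𝒬.b l‖ + 𝒬.normT l))) :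
    FinSuppEmbeds Y univ (𝒬.weight k p ∞) 1 := by
  refine finSuppEmbeds_of_sum_le (weight_nonneg 𝒬 k p ∞) one_ne_zero ENNReal.one_ne_top jf ?_
  obtain ⟨C, hC⟩ := exists_eLpNorm_sum_atoms_le hp h hφ hY hbdd ψ
  set m := atomConst ψ k with hm
  have hm0 : 0 < m := atomConst_pos ψ k
  refine ⟨(2 / κ ^ k / m).toNNReal * C, fun j S c hj _ => ?_⟩
  set G : I → ℂ :=
    fun l => multiDeriv (Pi.single j k) (normAtom p ψ (𝒬.T l) (ζ l) 0) 0 with hG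
  -- Where `G l = 0` the quotient is `0`, so `‖a l‖ ≤ ‖c l‖` holds in any case.
  set a : I → ℂ :=
    fun l => (‖(c : I → ℂ) l‖ : ℂ) * ((starRingEnd ℂ) (G l) / (‖G l‖ : ℂ)) with ha
  have haG : ∀ l, a l * G l = ((‖(c : I → ℂ) l‖ * ‖G l‖ : ℝ) : ℂ) := by
    intro l
    simp only [ha]
    rcases eq_or_ne (G l) 0 with h0 | h0
    · simp [h0]
    · have h1 : (‖G l‖ : ℂ) ≠ 0 := by exact_mod_cast norm_ne_zero_iff.2 h0
      have h2 : (starRingEnd ℂ) (G l) * G l = (‖G l‖ : ℂ) ^ 2 := Complex.conj_mul' _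
      push_cast
      field_simp
      linear_combination (‖(c : I → ℂ) l‖ : ℂ) * h2
  have han : ∀ l ∈ S, ‖a l‖ ≤ ‖(c : I → ℂ) l‖ := by
    intro l _
    simp only [ha, norm_mul, norm_div, Complex.norm_real, norm_norm, RCLike.norm_conj]
    exact mul_le_of_le_one_right (norm_nonneg _) (div_self_le_one _)
  have hup := hC 𝒬.T ζ (fun _ => 0) (fun l => κ * (‖𝒬.b l‖ + 𝒬.normT l)) j S c a
    (fun l hl => hj l hl ▸ hfit l) han
  have hval := (enorm_le_eLpNorm_top (SchwartzMap.continuous _) 0).trans hup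
  have hsum : multiDeriv (Pi.single j k) (∑ l ∈ S, a l • normAtom p ψ (𝒬.T l) (ζ l) 0) 0 =
      ((∑ l ∈ S, ‖(c : I → ℂ) l‖ * ‖G l‖ : ℝ) : ℂ) := by
    rw [multiDeriv_single_sum]
    push_cast
    exact Finset.sum_congr rfl fun l _ => by simpa using haG l
  rw [hsum, ← ofReal_norm, Complex.norm_real,
    Real.norm_of_nonneg (Finset.sum_nonneg fun _ _ => by positivity)] at hval
  have hterm : ∀ l ∈ S, 𝒬.weight k p ∞ l * ‖(c : I → ℂ) l‖ ≤
      2 / κ ^ k / m * (‖(c : I → ℂ) l‖ * ‖G l‖) := by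
    intro l hl
    have hf : FitsInto 𝒬 ψ l j (𝒬.T l) (ζ l) (κ * (‖𝒬.b l‖ + 𝒬.normT l)) := hj l hl ▸ hfit l
    have h1 := hf.le_norm_multiDeriv p k 0 0
      (by have := ψ.rOut_pos; rw [sub_zero, map_zero, norm_zero]; positivity)
    have h2 := weight_le 𝒬 k p ∞ hκ l
    have e0 : (1 / p).toReal - (1 / (∞ : ℝ≥0∞)).toReal = (1 / p).toReal := by simp
    rw [e0] at h2
    calc _ ≤ 2 / κ ^ k * (detAbs (𝒬.T l) ^ (1 / p).toReal *
          (κ * (‖𝒬.b l‖ + 𝒬.normT l)) ^ k) * ‖(c : I → ℂ) l‖ := by gcongr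
      _ = 2 / κ ^ k / m * (‖(c : I → ℂ) l‖ * (m * (detAbs (𝒬.T l) ^ (1 / p).toReal *
          (κ * (‖𝒬.b l‖ + 𝒬.normT l)) ^ k))) := by field_simp
      _ ≤ _ := by gcongr
  simp only [ENNReal.toReal_one, Real.rpow_one, ENNReal.rpow_one]
  rw [← ENNReal.ofReal_sum_of_nonneg fun l _ =>
    mul_nonneg (weight_nonneg 𝒬 k p ∞ l) (norm_nonneg _)]
  calc _ ≤ ENNReal.ofReal (2 / κ ^ k / m * ∑ l ∈ S, ‖(c : I → ℂ) l‖ * ‖G l‖) := by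
        refine ENNReal.ofReal_le_ofReal ?_
        rw [Finset.mul_sum]
        exact Finset.sum_le_sum hterm
    _ = ENNReal.ofReal (2 / κ ^ k / m) * ENNReal.ofReal (∑ l ∈ S, ‖(c : I → ℂ) l‖ * ‖G l‖) :=
        ENNReal.ofReal_mul (by positivity)
    _ ≤ ENNReal.ofReal (2 / κ ^ k / m) * (C * ENNReal.ofReal (Y.qnorm c)) := by gcongr
    _ = _ := by
        rw [ENNReal.ofReal]
        push_cast
        ring

/-- A weighted `ℓ²` sum is controlled by the `L²` norm of the square function, hence by its `L^q`
norm on a set of finite measure. -/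
lemma lintegral_ofReal_rpow_le {H : E d → ℝ} (hH : Measurable H) (hH0 : ∀ y, 0 ≤ H y)
    {B : Set (E d)} {r : ℝ} (hr : 2 ≤ r) :
    (∫⁻ y in B, ENNReal.ofReal (H y)) ≤
      (∫⁻ y, ENNReal.ofReal (H y ^ (r / 2))) ^ (2 / r) * volume B ^ (1 - 2 / r) := by
  have hr0 : 0 < r := by linarith
  have h1 : 0 ≤ 1 - 2 / r := by
    rw [sub_nonneg, div_le_iff₀ hr0]; linarith
  -- Set-up for Hölder with weights `2/r` and `1 - 2/r`; the latter is `0` when `r = 2`.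
  have e : ∀ y, ENNReal.ofReal (H y) =
      ENNReal.ofReal (H y ^ (r / 2)) ^ (2 / r) * (1 : ℝ≥0∞) ^ (1 - 2 / r) := by
    intro y
    rw [ENNReal.ofReal_rpow_of_nonneg (Real.rpow_nonneg (hH0 y) _) (by positivity),
      ← Real.rpow_mul (hH0 y)]
    have : r / 2 * (2 / r) = 1 := by field_simp
    rw [this]; simp
  calc _ = ∫⁻ y in B, ENNReal.ofReal (H y ^ (r / 2)) ^ (2 / r) * (1 : ℝ≥0∞) ^ (1 - 2 / r) := by
        simp_rw [← e]
    _ ≤ (∫⁻ y in B, ENNReal.ofReal (H y ^ (r / 2))) ^ (2 / r) *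
          (∫⁻ _ in B, 1) ^ (1 - 2 / r) :=
        ENNReal.lintegral_mul_norm_pow_le (hH.pow_const _).ennreal_ofReal.aemeasurable
          aemeasurable_const (by positivity) h1 (by ring)
    _ ≤ _ := by
        rw [setLIntegral_const, one_mul]
        gcongr
        exact Measure.restrict_le_self

/-- Cores centred at `0` all lie in one ball `B`, because `‖T_l⁻¹‖ ≤ M`. On `B` the `L²` norm of the
square function is controlled by its `L^q` norm, and its square is exactly `∑ β_l² |core_l|`,
however the cores overlap. -/
theorem finSuppEmbeds_weight_two (hp : 0 < p) (hq2 : 2 ≤ q) (hqt : q ≠ ∞)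
    (h : 𝒬.IsSemiStructured (O : Set (E d))) (hφ : 𝒬.IsBAPU p φ) (hY : Y.IsRegular 𝒬)
    (hbdd : ∀ α : Fin d → ℕ, ∑ j, α j = k → DerivBounded φ p q Y α)
    {ψ : ContDiffBump (0 : E d)} {κ : ℝ} (hκ : 0 < κ) {jf : I → Fin d} {ζ : I → E d}
    (hfit : ∀ l, FitsInto 𝒬 ψ l (jf l) (𝒬.T l) (ζ l) (κ * (‖𝒬.b l‖ + 𝒬.normT l)))
    {J : Set I} {M : ℝ} (hM : ∀ i ∈ J, 𝒬.normTinv i ≤ M) :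
    FinSuppEmbeds Y J (𝒬.weight k p 2) 2 := by
  classical
  have hq : 0 < q := two_pos.trans_le hq2
  refine finSuppEmbeds_of_sum_le (weight_nonneg 𝒬 k p 2) two_ne_zero ENNReal.ofNat_ne_top jf ?_
  obtain ⟨C, hC⟩ := exists_lintegral_squareFunction_le hp hq hqt h hφ hY hbdd ψ
  have hr2 : 2 ≤ q.toReal := by
    simpa using (ENNReal.toReal_le_toReal ENNReal.ofNat_ne_top hqt).2 hq2
  set r := q.toReal with hrdef
  have hr : 0 < r := by linarith
  set v := volume (Metric.closedBall (0 : E d) (1 / (6 * ψ.rOut))) with hv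
  have hv0 : v ≠ 0 := volume_coreBall_ne_zero ψ
  have hvt : v ≠ ∞ := measure_closedBall_lt_top.ne
  set B := Metric.closedBall (0 : E d) (M * (1 / (6 * ψ.rOut))) with hB
  have hBt : volume B ≠ ∞ := measure_closedBall_lt_top.ne
  have h1r : 0 ≤ 1 - 2 / r := by
    rw [sub_nonneg, div_le_iff₀ hr]; linarith
  refine ⟨((2 / κ ^ k) ^ 2).toNNReal * v⁻¹.toNNReal *
    (C ^ (2 / r) * (volume B ^ (1 - 2 / r)).toNNReal), fun j S c hj hJ => ?_⟩
  set W : I → ℝ := fun l => κ * (‖𝒬.b l‖ + 𝒬.normT l) with hW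
  have hW0 : ∀ l, 0 ≤ W l := fun l => (hfit l).1
  have main := hC 𝒬.T ζ (fun _ => 0) W j S c fun l hl => hj l hl ▸ hfit l
  set β : I → ℝ := fun l => ‖(c : I → ℂ) l‖ * (detAbs (𝒬.T l) ^ (1 / p).toReal * W l ^ k) with hβ
  have hβ0 : ∀ l, 0 ≤ β l := fun l => by
    have := (detAbs_pos (𝒬.T l)).le
    have := hW0 l
    positivity
  set H : E d → ℝ := fun y => ∑ l ∈ S, (coreSet ψ (𝒬.T l) 0).indicator (fun _ => β l ^ 2) y with hH
  have hH0 : ∀ y, 0 ≤ H y := fun y => Finset.sum_nonneg fun l _ =>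
    indicator_nonneg (fun _ _ => by positivity) _
  have hHm : Measurable H := Finset.measurable_fun_sum S fun l _ =>
    measurable_const.indicator (measurableSet_coreSet ψ _ _)
  have hsub : ∀ l ∈ S, coreSet ψ (𝒬.T l) 0 ⊆ B := fun l hl y hy => by
    rw [hB, mem_closedBall_zero_iff]
    refine norm_le_of_norm_adj_le (𝒬.T l) (hM l (hJ l hl)) y ?_
    simpa [coreSet] using hy
  have lower : ∑ l ∈ S, ENNReal.ofReal (β l ^ 2) * (ENNReal.ofReal (detAbs (𝒬.T l))⁻¹ * v) ≤
      (C * ENNReal.ofReal (Y.qnorm c) ^ r) ^ (2 / r) * volume B ^ (1 - 2 / r) := by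
    calc _ = ∑ l ∈ S, ∫⁻ y in B, (coreSet ψ (𝒬.T l) 0).indicator
            (fun _ => ENNReal.ofReal (β l ^ 2)) y := by
          refine Finset.sum_congr rfl fun l hl => ?_
          rw [lintegral_indicator_const (measurableSet_coreSet ψ _ _),
            Measure.restrict_apply (measurableSet_coreSet ψ _ _),
            inter_eq_self_of_subset_left (hsub l hl), volume_coreSet]
      _ = ∫⁻ y in B, ∑ l ∈ S, (coreSet ψ (𝒬.T l) 0).indicator
            (fun _ => ENNReal.ofReal (β l ^ 2)) y :=
          (lintegral_finsetSum _ fun l _ =>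
            measurable_const.indicator (measurableSet_coreSet ψ _ _)).symm
      _ = ∫⁻ y in B, ENNReal.ofReal (H y) := by
          refine lintegral_congr fun y => ?_
          rw [hH, ENNReal.ofReal_sum_of_nonneg fun l _ =>
            indicator_nonneg (fun _ _ => by positivity) _]
          refine Finset.sum_congr rfl fun l _ => ?_
          by_cases hy : y ∈ coreSet ψ (𝒬.T l) 0 <;> simp [hy]
      _ ≤ _ := lintegral_ofReal_rpow_le hHm hH0 hr2
      _ ≤ _ := by gcongr
  have hterm : ∀ l, ENNReal.ofReal ((𝒬.weight k p 2 l * ‖(c : I → ℂ) l‖) ^ (2 : ℝ≥0∞).toReal) ≤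
      ENNReal.ofReal ((2 / κ ^ k) ^ 2) * v⁻¹ * (ENNReal.ofReal (β l ^ 2) *
        (ENNReal.ofReal (detAbs (𝒬.T l))⁻¹ * v)) := by
    intro l
    have hD := detAbs_pos (𝒬.T l)
    have hWl := hW0 l
    have e1 : (𝒬.weight k p 2 l * ‖(c : I → ℂ) l‖) ^ (2 : ℝ≥0∞).toReal ≤
        (2 / κ ^ k) ^ 2 * (β l ^ 2 * (detAbs (𝒬.T l))⁻¹) := by
      rw [ENNReal.toReal_ofNat, Real.rpow_ofNat]
      calc _ ≤ ((2 / κ ^ k) * (detAbs (𝒬.T l) ^ ((1 / p).toReal - (1 / (2 : ℝ≥0∞)).toReal) *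
              W l ^ k) * ‖(c : I → ℂ) l‖) ^ 2 := by
            have := weight_nonneg 𝒬 k p 2 l
            gcongr
            exact weight_le 𝒬 k p 2 hκ l
        _ = ((2 / κ ^ k) * (β l * detAbs (𝒬.T l) ^ (-(1 / (2 : ℝ≥0∞)).toReal))) ^ 2 := by
            rw [sub_eq_add_neg, Real.rpow_add hD]
            congr 1
            simp only [hβ]
            ring
        _ = _ := by
            have : (detAbs (𝒬.T l) ^ (-(1 / (2 : ℝ≥0∞)).toReal)) ^ 2 = (detAbs (𝒬.T l))⁻¹ := by
              rw [← Real.rpow_natCast, ← Real.rpow_mul hD.le, ← Real.rpow_neg_one]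
              congr 1
              simp
            rw [mul_pow, mul_pow, this]
    calc _ ≤ ENNReal.ofReal ((2 / κ ^ k) ^ 2 * (β l ^ 2 * (detAbs (𝒬.T l))⁻¹)) :=
          ENNReal.ofReal_le_ofReal e1
      _ = ENNReal.ofReal ((2 / κ ^ k) ^ 2) * (ENNReal.ofReal (β l ^ 2) *
            ENNReal.ofReal (detAbs (𝒬.T l))⁻¹) * (v⁻¹ * v) := by
          rw [ENNReal.inv_mul_cancel hv0 hvt, mul_one, ENNReal.ofReal_mul (by positivity),
            ENNReal.ofReal_mul (by positivity)]
      _ = _ := by ring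
  calc _ ≤ ∑ l ∈ S, ENNReal.ofReal ((2 / κ ^ k) ^ 2) * v⁻¹ * (ENNReal.ofReal (β l ^ 2) *
        (ENNReal.ofReal (detAbs (𝒬.T l))⁻¹ * v)) := Finset.sum_le_sum fun l _ => hterm l
    _ ≤ ENNReal.ofReal ((2 / κ ^ k) ^ 2) * v⁻¹ *
          ((C * ENNReal.ofReal (Y.qnorm c) ^ r) ^ (2 / r) * volume B ^ (1 - 2 / r)) := by
        rw [← Finset.mul_sum]
        gcongr
    _ = _ := by
        rw [ENNReal.mul_rpow_of_nonneg _ _ (by positivity), ← ENNReal.rpow_mul,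
          mul_div_cancel₀ _ hr.ne', ENNReal.toReal_ofNat]
        push_cast
        rw [ENNReal.coe_toNNReal (ENNReal.inv_ne_top.2 hv0),
          ENNReal.coe_toNNReal (ENNReal.rpow_ne_top_of_nonneg h1r hBt),
          ENNReal.coe_rpow_of_nonneg _ (by positivity), ENNReal.ofReal]
        ring

/-- Multiplication by a nonzero real number. -/
def scaling (d : ℕ) {t : ℝ} (ht : t ≠ 0) : E d ≃L[ℝ] E d :=
  ContinuousLinearEquiv.smulLeft (Units.mk0 t ht)

lemma scaling_apply {t : ℝ} (ht : t ≠ 0) (η : E d) : scaling d ht η = t • η := rfl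

/-- Since `‖T_l⁻¹‖ ≤ M`, the map `M⁻¹ · id` sends the bump's support into its image under each
`T_l`, so it can replace every `T_l`. All cores then coincide and the square function is constant
there, which gives `ℓ²` for every finite `q`; the determinant is a fixed constant, hence the trivial
exponent `1/p - 1/p`. -/
theorem finSuppEmbeds_weight_diag (hp : 0 < p) (hq : 0 < q) (hqt : q ≠ ∞)
    (h : 𝒬.IsSemiStructured (O : Set (E d))) (hφ : 𝒬.IsBAPU p φ) (hY : Y.IsRegular 𝒬)
    (hbdd : ∀ α : Fin d → ℕ, ∑ j, α j = k → DerivBounded φ p q Y α)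
    {ψ : ContDiffBump (0 : E d)} {κ : ℝ} (hκ : 0 < κ) {jf : I → Fin d} {ζ : I → E d}
    (hfit : ∀ l, FitsInto 𝒬 ψ l (jf l) (𝒬.T l) (ζ l) (κ * (‖𝒬.b l‖ + 𝒬.normT l)))
    {J : Set I} {M : ℝ} (hM0 : 0 < M) (hM : ∀ i ∈ J, 𝒬.normTinv i ≤ M) :
    FinSuppEmbeds Y J (𝒬.weight k p p) 2 := by
  classical
  refine finSuppEmbeds_of_sum_le (weight_nonneg 𝒬 k p p) two_ne_zero ENNReal.ofNat_ne_top jf ?_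
  obtain ⟨C, hC⟩ := exists_lintegral_squareFunction_le hp hq hqt h hφ hY hbdd ψ
  set r := q.toReal with hrdef
  have hr : 0 < r := ENNReal.toReal_pos hq.ne' hqt
  set A := scaling d (inv_ne_zero hM0.ne') with hA
  set D := detAbs A ^ (1 / p).toReal with hD
  have hD0 : 0 < D := Real.rpow_pos_of_pos (detAbs_pos A) _
  set V := volume (coreSet ψ A 0) with hV
  have hV0 : V ≠ 0 := by
    rw [hV, volume_coreSet]
    refine mul_ne_zero ?_ (volume_coreBall_ne_zero ψ)
    rw [ENNReal.ofReal_ne_zero_iff]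
    exact inv_pos.2 (detAbs_pos A)
  have hVt : V ≠ ∞ := by
    rw [hV, volume_coreSet]
    exact ENNReal.mul_ne_top ENNReal.ofReal_ne_top measure_closedBall_lt_top.ne
  have hfitA : ∀ l ∈ J, FitsInto 𝒬 ψ l (jf l) A (ζ l) (κ * (‖𝒬.b l‖ + 𝒬.normT l)) := by
    intro l hl
    obtain ⟨hW, s, hs, H⟩ := hfit l
    refine ⟨hW, s, hs, fun η hη => ?_⟩
    have e : A η = 𝒬.T l ((𝒬.T l).symm (A η)) := by simp
    rw [e]
    refine H _ (le_trans ?_ hη)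
    calc ‖(𝒬.T l).symm (A η)‖ ≤ 𝒬.normTinv l * ‖A η‖ :=
          ((𝒬.T l).symm : E d →L[ℝ] E d).le_opNorm _
      _ ≤ M * ‖A η‖ := by gcongr; exact hM l hl
      _ = ‖η‖ := by
          rw [hA, scaling_apply, norm_smul, norm_inv, Real.norm_of_nonneg hM0.le,
            mul_inv_cancel_left₀ hM0.ne']
  refine ⟨((2 / κ ^ k / D) ^ 2).toNNReal * (C ^ (2 / r) * (V⁻¹ ^ (2 / r)).toNNReal),
    fun j S c hj hJ => ?_⟩
  set W : I → ℝ := fun l => κ * (‖𝒬.b l‖ + 𝒬.normT l) with hW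
  have hW0 : ∀ l, 0 ≤ W l := fun l => (hfit l).1
  have main := hC (fun _ => A) ζ (fun _ => 0) W j S c fun l hl => hj l hl ▸ hfitA l (hJ l hl)
  set β : I → ℝ := fun l => ‖(c : I → ℂ) l‖ * (D * W l ^ k) with hβ
  set Q := ∑ l ∈ S, β l ^ 2 with hQ
  have hQ0 : 0 ≤ Q := Finset.sum_nonneg fun _ _ => by positivity
  have lower : ENNReal.ofReal (Q ^ (r / 2)) * V ≤ C * ENNReal.ofReal (Y.qnorm c) ^ r := by
    refine le_trans ?_ main
    rw [← lintegral_indicator_const (measurableSet_coreSet ψ A 0)]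
    refine lintegral_mono fun y => ?_
    by_cases hy : y ∈ coreSet ψ A 0
    · simp only [indicator_of_mem hy]
      exact le_rfl
    · simp only [indicator_of_notMem hy]
      exact zero_le
  have hQle : ENNReal.ofReal Q ≤
      (C * ENNReal.ofReal (Y.qnorm c) ^ r) ^ (2 / r) * V⁻¹ ^ (2 / r) := by
    have h1 : ENNReal.ofReal (Q ^ (r / 2)) ≤ C * ENNReal.ofReal (Y.qnorm c) ^ r * V⁻¹ := by
      rw [← div_eq_mul_inv, ENNReal.le_div_iff_mul_le (Or.inl hV0) (Or.inl hVt)]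
      exact lower
    have h2 := ENNReal.rpow_le_rpow h1 (by positivity : 0 ≤ 2 / r)
    rw [ENNReal.ofReal_rpow_of_nonneg (by positivity) (by positivity), ← Real.rpow_mul hQ0,
      ENNReal.mul_rpow_of_nonneg _ _ (by positivity : 0 ≤ 2 / r)] at h2
    have e : r / 2 * (2 / r) = 1 := by field_simp
    rwa [e, Real.rpow_one] at h2
  have hterm : ∀ l, (𝒬.weight k p p l * ‖(c : I → ℂ) l‖) ^ (2 : ℝ≥0∞).toReal ≤
      (2 / κ ^ k / D) ^ 2 * β l ^ 2 := by
    intro l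
    have hw := weight_le 𝒬 k p p hκ l
    rw [sub_self, Real.rpow_zero, one_mul] at hw
    have := weight_nonneg 𝒬 k p p l
    rw [ENNReal.toReal_ofNat, Real.rpow_ofNat, ← mul_pow]
    refine pow_le_pow_left₀ (by positivity) ?_ 2
    calc _ ≤ 2 / κ ^ k * W l ^ k * ‖(c : I → ℂ) l‖ := by gcongr
      _ = _ := by simp only [hβ]; field_simp
  calc _ ≤ ∑ l ∈ S, ENNReal.ofReal ((2 / κ ^ k / D) ^ 2 * β l ^ 2) :=
        Finset.sum_le_sum fun l _ => ENNReal.ofReal_le_ofReal (hterm l)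
    _ = ENNReal.ofReal ((2 / κ ^ k / D) ^ 2) * ENNReal.ofReal Q := by
        rw [← ENNReal.ofReal_sum_of_nonneg fun _ _ => by positivity, ← Finset.mul_sum,
          ENNReal.ofReal_mul (by positivity)]
    _ ≤ ENNReal.ofReal ((2 / κ ^ k / D) ^ 2) *
          ((C * ENNReal.ofReal (Y.qnorm c) ^ r) ^ (2 / r) * V⁻¹ ^ (2 / r)) := by gcongr
    _ = _ := by
        rw [ENNReal.mul_rpow_of_nonneg _ _ (by positivity), ← ENNReal.rpow_mul,
          mul_div_cancel₀ _ hr.ne', ENNReal.toReal_ofNat]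
        push_cast
        rw [ENNReal.coe_toNNReal (ENNReal.rpow_ne_top_of_nonneg (by positivity)
            (ENNReal.inv_ne_top.2 hV0)),
          ENNReal.coe_rpow_of_nonneg _ (by positivity), ENNReal.ofReal]
        ring

end Embeddings

end Decomp

end

/-! ### Assembly of the embeddings. -/

theorem mainTheorem3 {d : ℕ} (hd : 1 ≤ d) {I : Type*} (p q : ℝ≥0∞) (hp : 0 < p) (hq : 0 < q)
    (O : TopologicalSpace.Opens (Decomp.E d)) (hO : (O : Set (Decomp.E d)).Nonempty)
    (𝒬 : Decomp.AffineFamily d I) (h𝒬 : 𝒬.IsSemiStructured (O : Set (Decomp.E d)))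
    (htight : 𝒬.IsTight)
    (φ : I → 𝓓(O, ℂ)) (hφ : 𝒬.IsBAPU p φ)
    (Y : Decomp.SequenceSpace I) (hY : Y.IsRegular 𝒬) (k : ℕ)
    (hbdd : ∀ α : Fin d → ℕ, ∑ j, α j = k → Decomp.DerivBounded φ p q Y α) :
    Decomp.FinSuppEmbeds Y Set.univ (𝒬.weight k p q) q ∧
    (q = ∞ → Decomp.FinSuppEmbeds Y Set.univ (𝒬.weight k p q) 1) ∧
    (∀ (I₀ : Set I) (M : ℝ), 0 < M → (∀ i ∈ I₀, 𝒬.normTinv i ≤ M) →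
      (2 ≤ q → q ≠ ∞ → Decomp.FinSuppEmbeds Y I₀ (𝒬.weight k p 2) 2) ∧
      (q ≠ ∞ → Decomp.FinSuppEmbeds Y I₀ (𝒬.weight k p p) 2)) := by
  obtain ⟨ρ, hρ, κ, hκ, hcenter⟩ := Decomp.exists_center hd h𝒬 htight
  choose ζ jf s hs H using hcenter
  -- The outer radius `ρ / 2` keeps the closed support inside the open ball of radius `ρ` given by
  -- `H`.
  let ψ : ContDiffBump (0 : Decomp.E d) := ⟨ρ / 4, ρ / 2, by positivity, by linarith⟩
  have hfit : ∀ l, Decomp.FitsInto 𝒬 ψ l (jf l) (𝒬.T l) (ζ l)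
      (κ * (‖𝒬.b l‖ + 𝒬.normT l)) := fun l =>
    ⟨mul_nonneg hκ.le (add_nonneg (norm_nonneg _) (norm_nonneg _)), s l, hs l, fun η hη =>
      H l η (lt_of_le_of_lt hη (by change ρ / 2 < ρ; linarith))⟩
  have one : q = ∞ → Decomp.FinSuppEmbeds Y Set.univ (𝒬.weight k p q) 1 := by
    rintro rfl
    exact Decomp.finSuppEmbeds_weight_one hp h𝒬 hφ hY hbdd hκ hfit
  refine ⟨?_, one, fun I₀ M hM0 hM => ⟨fun hq2 hqt => ?_, fun hqt => ?_⟩⟩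
  -- The square function argument needs finite `q`; for `q = ∞` the stronger `ℓ¹` embedding is used.
  · rcases eq_or_ne q ∞ with rfl | hqt
    · exact (one rfl).top_of_one
    · exact Decomp.finSuppEmbeds_weight_self hd hp hq hqt h𝒬 hφ hY hbdd hκ hfit
  · exact Decomp.finSuppEmbeds_weight_two hp hq2 hqt h𝒬 hφ hY hbdd hκ hfit hM
  · exact Decomp.finSuppEmbeds_weight_diag hp hq hqt h𝒬 hφ hY hbdd hκ hfit hM0 hM
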